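/- Let $a,b>0$, $0<A_0\le 1$, $\xi>0$. Let the channel gain be $\lambda=I_aI_p$ with $I_a,I_p$ independent, where $I_a$ has the Gamma-Gamma density $$f_{I_a}(x)=\frac{2(ab)^{(a+b)/2}}{\Gamma(a)\Gamma(b)}\,x^{(a+b)/2-1}K_{a-b}\bigl(2\sqrt{abx}\bigr),\qquad x>0,$$ ($K_\nu$ the modified Bessel function of the second kind) and $I_p$ (pointing error) has the density $$f_{I_p}(x)=\frac{\xi^2}{A_0^{\xi^2}}\,x^{\xi^2-1},\qquad 0\le x\le A_0 .$$ Let $k\in\{1,2\}$ ($k=1$: heterodyne detection, $k=2$: intensity modulation with direct detection), let $N_k>0$ be the noise level, $P_{\mathrm{avg}}>0$ the average power, and $\mathrm{SNR}_k=P_{\mathrm{avg}}/N_k$. The ergodic capacity is $$\bar C=\max_{P}\ \frac1k\,\mathbb E\Bigl[\log\Bigl(1+\frac{\lambda P(\lambda)}{N_k}\Bigr)\Bigr],$$ over all nonnegative power policies $P$ with $\mathbb E[P(\lambda)]\le P_{\mathrm{avg}}$. The maximum is attained by waterfilling, $P(\lambda)/N_k=(1/\mu_k-1/\lambda)^+$,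 where $\mu_k>0$ is the unique solution of $\mathbb E[(1/\mu_k-1/\lambda)^+]=\mathrm{SNR}_k$, so that $\bar C=\frac1k\,\mathbb E\bigl[\log(\lambda/\mu_k)\,\mathbf 1_{\{\lambda>\mu_k\}}\bigr]$. Moreover, with $a,b,A_0,\xi,k,N_k$ fixed: (i) (low SNR) as $\mathrm{SNR}_k\to0^+$, $$\bar C\sim\frac1k\,\frac{A_0}{4ab}\,\mathrm{SNR}_k\log^2\Bigl(\frac1{\mathrm{SNR}_k}\Bigr),$$ i.e. the ratio of the two sides tends to $1$; (ii) (high SNR) as $\mathrm{SNR}_k\to\infty$, $$\bar C=\frac1k\Bigl[\log\mathrm{SNR}_k+\log\frac{A_0}{ab}+\psi(a)+\psi(b)-\frac1{\xi^2}\Bigr]+o(1),$$ where $\psi$ is the digamma function. -/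

import Mathlib

open MeasureTheory Filter Topology Asymptotics

noncomputable section

namespace FSO

/-- The modified Bessel function of the second kind `K_ν(z)`, for real order `ν` and `z > 0`,
through the classical integral representation
`K_ν(z) = (1/2) (z/2)^ν ∫₀^∞ exp(-t - z²/(4t)) t^(-ν-1) dt`. -/
def besselK (ν z : ℝ) : ℝ :=
  (1 / 2) * (z / 2) ^ ν * ∫ t in Set.Ioi (0 : ℝ), Real.exp (-t - z ^ 2 / (4 * t)) * t ^ (-ν - 1)

/-- The digamma function `ψ` at a real argument (where it takes real values). -/
def psi (x : ℝ) : ℝ := (Complex.digamma (x : ℂ)).re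

/-- Density of the Gamma-Gamma distribution of the turbulence-induced irradiance `I_a`. -/
def gammaGammaPDF (a b x : ℝ) : ℝ :=
  if 0 < x then
    2 * (a * b) ^ ((a + b) / 2) / (Real.Gamma a * Real.Gamma b) * x ^ ((a + b) / 2 - 1)
      * besselK (a - b) (2 * Real.sqrt (a * b * x))
  else 0

/-- Density of the pointing-error irradiance `I_p`, supported on `[0, A₀]`. -/
def pointingPDF (A0 ξ x : ℝ) : ℝ :=
  if 0 ≤ x ∧ x ≤ A0 then ξ ^ 2 / A0 ^ (ξ ^ 2) * x ^ (ξ ^ 2 - 1) else 0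

/-- Law of the turbulence-induced irradiance `I_a`. -/
def turbulenceLaw (a b : ℝ) : Measure ℝ :=
  volume.withDensity fun x => ENNReal.ofReal (gammaGammaPDF a b x)

/-- Law of the pointing-error irradiance `I_p`. -/
def pointingLaw (A0 ξ : ℝ) : Measure ℝ :=
  volume.withDensity fun x => ENNReal.ofReal (pointingPDF A0 ξ x)

/-- Law of the channel gain `I = I_a * I_p`, with `I_a` and `I_p` independent. -/
def gainLaw (a b A0 ξ : ℝ) : Measure ℝ :=
  ((turbulenceLaw a b).prod (pointingLaw A0 ξ)).map fun p : ℝ × ℝ => p.1 * p.2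

/-- The feasible power policies for a channel gain of law `m`: nonnegative measurable functions
of the gain whose mean is finite and at most `Pavg`. -/
def feasiblePolicies (m : Measure ℝ) (Pavg : ℝ) : Set (ℝ → ℝ) :=
  {P | Measurable P ∧ (∀ x, 0 ≤ P x) ∧ Integrable P m ∧ ∫ x, P x ∂m ≤ Pavg}

/-- The average spectral efficiency (in nats per symbol) of the power policy `P`:
`(1/k) E[log(1 + λ P(λ) / N)]`. -/
def averageRate (m : Measure ℝ) (k : ℕ) (N : ℝ) (P : ℝ → ℝ) : ℝ :=
  1 / (k : ℝ) * ∫ x, Real.log (1 + x * P x / N) ∂m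

/-- The ergodic capacity: the largest average spectral efficiency over all feasible policies. -/
def ergodicCapacity (m : Measure ℝ) (k : ℕ) (Pavg N : ℝ) : ℝ :=
  sSup (averageRate m k N '' feasiblePolicies m Pavg)

/-- The waterfilling policy with threshold `μ`: `P(λ) / N = (1/μ - 1/λ)⁺`. -/
def waterfilling (N μ x : ℝ) : ℝ := N * max (1 / μ - 1 / x) 0

/-- The power constraint `E[(1/μ - 1/λ)⁺] = SNR` that determines the threshold `μ > 0`. -/
def IsThreshold (m : Measure ℝ) (SNR μ : ℝ) : Prop :=
  0 < μ ∧ ∫ x, max (1 / μ - 1 / x) 0 ∂m = SNR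

end FSO

end

/-! Write S(μ) = `fillPower m μ` and R(μ) = `fillRate m μ`. Optimality of waterfilling is Lagrangian
duality done pointwise: by concavity of the logarithm, the rate of any power p lies below the rate
of the waterfilling power w plus μ(p - w). Integrating, the linear term is nonpositive under the
power constraint. The threshold comes from S being continuous and strictly decreasing.

Everything else rests on the factorization λ = G_a G_b V / (ab), where G_a, G_b are independent
gamma variables and V is the pointing error (`turbulenceLaw_eq_map`): conditioning on G_b turns the
product density into the integral that defines the Bessel function.

High SNR: as μ → 0, R(μ) = E log λ - log μ + o(1) and μ S(μ) → 1, so the capacity is log SNR + E log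
λ up to 1/k and o(1). The factorization makes E log λ a sum, with E log G_a = Γ'(a)/Γ(a).

Low SNR: put c = ab/A₀. The tail of λ at y is exp(-2√(cy)) to logarithmic precision, and no finer
asymptotics are needed. The upper bound is AM-GM with exponential moments, the lower bound a box
where G_a and G_b both exceed about √(cy) and V is near A₀. Hence log(1/S(μ)) ~ 2√(cμ). Since the
tail varies so fast, gains above (1 + δ)μ are negligible, and log t ~ 1 - 1/t near t = 1 gives R(μ)
~ μ S(μ). Eliminating μ yields S log²(1/S)/(4c). -/

namespace FSO

/-- Normalized power spent by waterfilling at threshold `μ`. -/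
noncomputable def fillPower (m : Measure ℝ) (μ : ℝ) : ℝ := ∫ x, max (1 / μ - 1 / x) 0 ∂m

/-- Rate (in nats) achieved by waterfilling at threshold `μ`. -/
noncomputable def fillRate (m : Measure ℝ) (μ : ℝ) : ℝ :=
  ∫ x in Set.Ioi μ, Real.log (x / μ) ∂m

/-! ### Waterfilling: threshold, optimality, and the high-power limit, for a general gain law. -/

section Fill

variable {m : Measure ℝ}

theorem measurable_excess (μ : ℝ) : Measurable fun x : ℝ => max (1 / μ - 1 / x) 0 := by
  fun_prop

theorem excess_le {μ x : ℝ} (hμ : 0 < μ) (hx : 0 < x) : max (1 / μ - 1 / x) 0 ≤ 1 / μ := by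
  have h1 : 0 < 1 / μ := by positivity
  have h2 : 0 < 1 / x := by positivity
  exact max_le (by linarith) h1.le

theorem norm_excess_le {μ x : ℝ} (hμ : 0 < μ) (hx : 0 < x) :
    ‖max (1 / μ - 1 / x) 0‖ ≤ 1 / μ := by
  rw [Real.norm_of_nonneg (le_max_right _ _)]
  exact excess_le hμ hx

theorem integrable_excess [IsFiniteMeasure m] (hpos : ∀ᵐ x ∂m, 0 < x) {μ : ℝ} (hμ : 0 < μ) :
    Integrable (fun x : ℝ => max (1 / μ - 1 / x) 0) m := by
  refine Integrable.mono' (integrable_const (1 / μ))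
    (measurable_excess μ).aestronglyMeasurable ?_
  filter_upwards [hpos] with x hx using norm_excess_le hμ hx

theorem fillPower_le [IsProbabilityMeasure m] (hpos : ∀ᵐ x ∂m, 0 < x) {μ : ℝ} (hμ : 0 < μ) :
    fillPower m μ ≤ 1 / μ := by
  calc fillPower m μ ≤ ∫ _x, 1 / μ ∂m := by
        refine integral_mono_ae (integrable_excess hpos hμ) (integrable_const _) ?_
        filter_upwards [hpos] with x hx using excess_le hμ hx
    _ = 1 / μ := by simp

theorem fillPower_ge [IsFiniteMeasure m] (hpos : ∀ᵐ x ∂m, 0 < x) {μ κ : ℝ} (hμ : 0 < μ)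
    (hκ : 1 < κ) : (1 / μ) * (1 - 1 / κ) * m.real (Set.Ioi (κ * μ)) ≤ fillPower m μ := by
  have hκ0 : 0 < κ := by linarith
  calc (1 / μ) * (1 - 1 / κ) * m.real (Set.Ioi (κ * μ))
      = ∫ _x in Set.Ioi (κ * μ), (1 / μ) * (1 - 1 / κ) ∂m := by
        simp [mul_comm]
    _ ≤ ∫ x in Set.Ioi (κ * μ), max (1 / μ - 1 / x) 0 ∂m := by
        refine setIntegral_mono_on (integrable_const _).integrableOn
          (integrable_excess hpos hμ).integrableOn measurableSet_Ioi fun x hx => ?_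
        have hx' : κ * μ < x := hx
        refine le_trans ?_ (le_max_left _ _)
        have : 1 / x ≤ 1 / (κ * μ) := one_div_le_one_div_of_le (by positivity) hx'.le
        have e : 1 / μ * (1 - 1 / κ) = 1 / μ - 1 / (κ * μ) := by field_simp
        linarith
    _ ≤ fillPower m μ :=
        setIntegral_le_integral (integrable_excess hpos hμ)
          (Eventually.of_forall fun _ => le_max_right _ _)

theorem fillPower_pos [IsFiniteMeasure m] (hpos : ∀ᵐ x ∂m, 0 < x)
    (htail : ∀ y : ℝ, 0 < m.real (Set.Ioi y)) {μ : ℝ} (hμ : 0 < μ) : 0 < fillPower m μ := by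
  refine lt_of_lt_of_le ?_ (fillPower_ge hpos hμ one_lt_two)
  have := htail (2 * μ)
  have h2 : (0 : ℝ) < 1 - 1 / 2 := by norm_num
  positivity

theorem continuousOn_fillPower [IsProbabilityMeasure m] (hpos : ∀ᵐ x ∂m, 0 < x) :
    ContinuousOn (fillPower m) (Set.Ioi 0) := by
  intro μ₀ hμ₀
  have hμ₀' : 0 < μ₀ := hμ₀
  refine ContinuousAt.continuousWithinAt ?_
  refine continuousAt_of_dominated (bound := fun _ => 1 / (μ₀ / 2)) ?_ ?_ (integrable_const _) ?_
  · exact Eventually.of_forall fun μ => (measurable_excess μ).aestronglyMeasurable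
  · filter_upwards [lt_mem_nhds (show μ₀ / 2 < μ₀ by linarith)] with μ hμ
    filter_upwards [hpos] with x hx
    exact (norm_excess_le (by linarith) hx).trans
      (one_div_le_one_div_of_le (by linarith) hμ.le)
  · refine Eventually.of_forall fun x => ?_
    have : ContinuousAt (fun μ : ℝ => 1 / μ) μ₀ := by
      simpa using continuousAt_inv₀ hμ₀'.ne'
    exact (this.sub continuousAt_const).max continuousAt_const

/-- Above the larger threshold both excesses are active and differ by exactly 1/μ - 1/ν; positive
tail mass makes the decrease strict. -/
theorem strictAntiOn_fillPower [IsProbabilityMeasure m] (hpos : ∀ᵐ x ∂m, 0 < x)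
    (htail : ∀ y : ℝ, 0 < m.real (Set.Ioi y)) : StrictAntiOn (fillPower m) (Set.Ioi 0) := by
  intro μ hμ ν hν hlt
  have hμ' : 0 < μ := hμ
  have hν' : 0 < ν := hν
  have hinv : 1 / ν < 1 / μ := one_div_lt_one_div_of_lt hμ' hlt
  have hi := (integrable_excess hpos hμ').sub (integrable_excess hpos hν')
  have key : (1 / μ - 1 / ν) * m.real (Set.Ioi ν) ≤ fillPower m μ - fillPower m ν := by
    have e : fillPower m μ - fillPower m ν
        = ∫ x, (max (1 / μ - 1 / x) 0 - max (1 / ν - 1 / x) 0) ∂m :=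
      (integral_sub (integrable_excess hpos hμ') (integrable_excess hpos hν')).symm
    rw [e]
    calc (1 / μ - 1 / ν) * m.real (Set.Ioi ν) = ∫ _x in Set.Ioi ν, (1 / μ - 1 / ν) ∂m := by
          simp [mul_comm]
      _ ≤ ∫ x in Set.Ioi ν, (max (1 / μ - 1 / x) 0 - max (1 / ν - 1 / x) 0) ∂m := by
          refine setIntegral_mono_on (integrable_const _).integrableOn
            hi.integrableOn measurableSet_Ioi fun x hx => ?_
          have : 1 / x ≤ 1 / ν := one_div_le_one_div_of_le hν' (le_of_lt hx)
          rw [max_eq_left (a := 1 / ν - 1 / x) (by linarith)]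
          have := le_max_left (1 / μ - 1 / x) 0
          linarith
      _ ≤ _ := by
          refine setIntegral_le_integral hi (Eventually.of_forall fun x => ?_)
          simp only [Pi.zero_apply, sub_nonneg]
          exact max_le_max (by linarith) le_rfl
  have : 0 < (1 / μ - 1 / ν) * m.real (Set.Ioi ν) := mul_pos (by linarith) (htail ν)
  linarith

/-- The integrand (1 - μ/x)⁺ is bounded by 1 and tends to 1 for every x > 0. -/
theorem tendsto_mul_fillPower [IsProbabilityMeasure m] (hpos : ∀ᵐ x ∂m, 0 < x) :
    Tendsto (fun μ => μ * fillPower m μ) (𝓝[>] 0) (𝓝 1) := by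
  have h1 : (1 : ℝ) = ∫ _x, (1 : ℝ) ∂m := by simp
  rw [h1]
  have h2 : ∀ μ, μ * fillPower m μ = ∫ x, μ * max (1 / μ - 1 / x) 0 ∂m := fun μ =>
    (integral_const_mul _ _).symm
  simp_rw [h2]
  refine tendsto_integral_filter_of_dominated_convergence (fun _ => 1) ?_ ?_
    (integrable_const _) ?_
  · exact Eventually.of_forall fun μ =>
      ((measurable_excess μ).const_mul μ).aestronglyMeasurable
  · filter_upwards [self_mem_nhdsWithin] with μ hμ
    have hμ' : 0 < μ := hμ
    filter_upwards [hpos] with x hx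
    rw [norm_mul, Real.norm_of_nonneg hμ'.le]
    calc μ * ‖max (1 / μ - 1 / x) 0‖ ≤ μ * (1 / μ) :=
          mul_le_mul_of_nonneg_left (norm_excess_le hμ' hx) hμ'.le
      _ = 1 := by field_simp
  · filter_upwards [hpos] with x hx
    have : Tendsto (fun μ : ℝ => 1 - μ / x) (𝓝[>] 0) (𝓝 1) := by
      have : Tendsto (fun μ : ℝ => 1 - μ / x) (𝓝 0) (𝓝 (1 - 0 / x)) :=
        (continuous_const.sub (continuous_id.div_const x)).tendsto 0
      simpa using this.mono_left nhdsWithin_le_nhds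
    refine this.congr' ?_
    filter_upwards [Ioo_mem_nhdsGT hx] with μ hμ
    have hμ0 : 0 < μ := hμ.1
    have : 1 / x ≤ 1 / μ := one_div_le_one_div_of_le hμ0 hμ.2.le
    rw [max_eq_left (by linarith)]
    field_simp

theorem exists_fillPower_eq [IsProbabilityMeasure m] (hpos : ∀ᵐ x ∂m, 0 < x) {s : ℝ}
    (hs : 0 < s) : ∃ μ, 0 < μ ∧ fillPower m μ = s := by
  -- Near 0 one has μ S(μ) > 1/2, so μ < 1/(2s) forces S(μ) > s. At the other end S(1/s) ≤ s, and
  -- the intermediate value theorem applies.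
  have hev := (tendsto_mul_fillPower hpos).eventually
    (lt_mem_nhds (show (1 / 2 : ℝ) < 1 by norm_num))
  have hsm : ∀ᶠ μ : ℝ in 𝓝[>] 0, μ ∈ Set.Ioo 0 (1 / (2 * s)) :=
    Ioo_mem_nhdsGT (by positivity)
  obtain ⟨μ₁, h1, h2⟩ := (hev.and hsm).exists
  have hμ₁ : 0 < μ₁ := h2.1
  have hs1 : s ≤ fillPower m μ₁ := by
    have h3 : μ₁ * (2 * s) < 1 := by
      have := h2.2
      rwa [lt_div_iff₀ (by positivity)] at this
    by_contra! hcon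
    have : μ₁ * fillPower m μ₁ ≤ μ₁ * s := mul_le_mul_of_nonneg_left hcon.le hμ₁.le
    linarith
  have hμ₂ : 0 < 1 / s := by positivity
  have hs2 : fillPower m (1 / s) ≤ s := by simpa using fillPower_le hpos hμ₂
  have := (convex_Ioi (0 : ℝ)).isPreconnected.intermediate_value (Set.mem_Ioi.2 hμ₂)
    (Set.mem_Ioi.2 hμ₁) (continuousOn_fillPower hpos)
  obtain ⟨μ, hμ, e⟩ := this ⟨hs2, hs1⟩
  exact ⟨μ, hμ, e⟩

theorem existsUnique_isThreshold [IsProbabilityMeasure m] (hpos : ∀ᵐ x ∂m, 0 < x)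
    (htail : ∀ y : ℝ, 0 < m.real (Set.Ioi y)) {s : ℝ} (hs : 0 < s) :
    ∃! μ, IsThreshold m s μ := by
  obtain ⟨μ, hμ, e⟩ := exists_fillPower_eq hpos hs
  exact ⟨μ, ⟨hμ, e⟩, fun ν hν =>
    (strictAntiOn_fillPower hpos htail).injOn hν.1 hμ (hν.2.trans e.symm)⟩

/-- Tangent line of the concave map p ↦ log(1 + xp) at the waterfilling power w. Its slope x/(1 +
xw) equals μ when w > 0, and is x ≤ μ when w = 0, where p - w ≥ 0: these are the KKT conditions. -/
theorem log_le_excess_rate {μ x p : ℝ} (hμ : 0 < μ) (hx : 0 < x) (hp : 0 ≤ p) :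
    Real.log (1 + x * p) ≤
      Real.log (1 + x * max (1 / μ - 1 / x) 0) + μ * (p - max (1 / μ - 1 / x) 0) := by
  set w := max (1 / μ - 1 / x) 0 with hw
  have hw0 : 0 ≤ w := le_max_right _ _
  have h1 : 0 < 1 + x * p := by positivity
  have h2 : 0 < 1 + x * w := by positivity
  have h3 : Real.log (1 + x * p) - Real.log (1 + x * w) ≤ (1 + x * p) / (1 + x * w) - 1 := by
    rw [← Real.log_div h1.ne' h2.ne']
    exact Real.log_le_sub_one_of_pos (by positivity)
  have h4 : (1 + x * p) / (1 + x * w) - 1 ≤ μ * (p - w) := by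
    rcases le_total (1 / x) (1 / μ) with h | h
    · have e : w = 1 / μ - 1 / x := max_eq_left (by linarith)
      have e2 : 1 + x * (1 / μ - 1 / x) = x / μ := by
        field_simp
        ring
      rw [e, e2]
      apply le_of_eq
      field_simp
      ring
    · have e : w = 0 := max_eq_right (by linarith)
      have hxm : x ≤ μ := by
        rwa [one_div_le_one_div hμ hx] at h
      rw [e]
      have := mul_le_mul_of_nonneg_right hxm hp
      simp only [mul_zero, add_zero, div_one, sub_zero]
      linarith
  linarith

theorem log_one_add_excess {μ x : ℝ} (hμ : 0 < μ) (hx : 0 < x) :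
    Real.log (1 + x * max (1 / μ - 1 / x) 0) =
      (Set.Ioi μ).indicator (fun x => Real.log (x / μ)) x := by
  by_cases h : μ < x
  · rw [Set.indicator_of_mem (Set.mem_Ioi.2 h), max_eq_left]
    · congr 1
      field_simp
      ring
    · have := one_div_le_one_div_of_le hμ h.le
      linarith
  · rw [Set.indicator_of_notMem (by simpa using h), max_eq_right]
    · simp
    · have := one_div_le_one_div_of_le hx (not_lt.1 h)
      linarith

theorem integral_log_one_add_excess (hpos : ∀ᵐ x ∂m, 0 < x) {μ : ℝ} (hμ : 0 < μ) :
    ∫ x, Real.log (1 + x * max (1 / μ - 1 / x) 0) ∂m = fillRate m μ := by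
  rw [fillRate, ← integral_indicator measurableSet_Ioi]
  refine integral_congr_ae ?_
  filter_upwards [hpos] with x hx using log_one_add_excess hμ hx

theorem integrable_log_one_add_excess (hpos : ∀ᵐ x ∂m, 0 < x)
    (hint : Integrable (fun x : ℝ => x) m) {μ : ℝ} (hμ : 0 < μ) :
    Integrable (fun x : ℝ => Real.log (1 + x * max (1 / μ - 1 / x) 0)) m := by
  refine Integrable.mono' (hint.const_mul (1 / μ)) ?_ ?_
  · exact (Real.measurable_log.comp
      ((measurable_id.mul (measurable_excess μ)).const_add 1)).aestronglyMeasurable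
  · filter_upwards [hpos] with x hx
    have h0 : 0 ≤ x * max (1 / μ - 1 / x) 0 := mul_nonneg hx.le (le_max_right _ _)
    rw [Real.norm_of_nonneg (Real.log_nonneg (by linarith))]
    calc Real.log (1 + x * max (1 / μ - 1 / x) 0) ≤ 1 + x * max (1 / μ - 1 / x) 0 - 1 :=
          Real.log_le_sub_one_of_pos (by linarith)
      _ ≤ x * (1 / μ) := by
          have := mul_le_mul_of_nonneg_left (excess_le hμ hx) hx.le
          linarith
      _ = 1 / μ * x := mul_comm _ _

theorem waterfilling_mem_feasiblePolicies [IsFiniteMeasure m] (hpos : ∀ᵐ x ∂m, 0 < x)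
    {N s μ : ℝ} (hN : 0 < N) (hμ : IsThreshold m s μ) :
    waterfilling N μ ∈ feasiblePolicies m (s * N) := by
  refine ⟨(measurable_excess μ).const_mul N, fun x => mul_nonneg hN.le (le_max_right _ _),
    (integrable_excess hpos hμ.1).const_mul N, ?_⟩
  have : ∫ x, waterfilling N μ x ∂m = N * s := by
    rw [← hμ.2]
    exact integral_const_mul _ _
  rw [this, mul_comm]

theorem mul_waterfilling_div {N : ℝ} (hN : 0 < N) (μ x : ℝ) :
    x * waterfilling N μ x / N = x * max (1 / μ - 1 / x) 0 := by
  unfold waterfilling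
  field_simp

theorem averageRate_waterfilling (hpos : ∀ᵐ x ∂m, 0 < x) (k : ℕ) {N μ : ℝ} (hN : 0 < N)
    (hμ : 0 < μ) : averageRate m k N (waterfilling N μ) = 1 / (k : ℝ) * fillRate m μ := by
  rw [averageRate, ← integral_log_one_add_excess hpos hμ]
  simp_rw [mul_waterfilling_div hN]

theorem isGreatest_averageRate_waterfilling [IsFiniteMeasure m] (hpos : ∀ᵐ x ∂m, 0 < x)
    (hint : Integrable (fun x : ℝ => x) m) (k : ℕ) {N s μ : ℝ} (hN : 0 < N)
    (hμ : IsThreshold m s μ) :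
    IsGreatest (averageRate m k N '' feasiblePolicies m (s * N))
      (averageRate m k N (waterfilling N μ)) := by
  refine ⟨⟨_, waterfilling_mem_feasiblePolicies hpos hN hμ, rfl⟩, ?_⟩
  rintro _ ⟨P, ⟨hPm, hP0, hPi, hPs⟩, rfl⟩
  rw [averageRate_waterfilling hpos k hN hμ.1, averageRate]
  refine mul_le_mul_of_nonneg_left ?_ (by positivity)
  have hiW := integrable_log_one_add_excess hpos hint hμ.1
  have hi2 : Integrable (fun x => μ * (P x / N - max (1 / μ - 1 / x) 0)) m :=
    ((hPi.div_const N).sub (integrable_excess hpos hμ.1)).const_mul μ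
  have hb : ∀ᵐ x ∂m, Real.log (1 + x * P x / N) ≤
      Real.log (1 + x * max (1 / μ - 1 / x) 0) + μ * (P x / N - max (1 / μ - 1 / x) 0) := by
    filter_upwards [hpos] with x hx
    rw [mul_div_assoc]
    exact log_le_excess_rate hμ.1 hx (div_nonneg (hP0 x) hN.le)
  -- The competitor's rate is nonnegative, so the pointwise upper bound also dominates it in norm;
  -- without integrability its integral would be the default 0.
  have hi1 : Integrable (fun x => Real.log (1 + x * P x / N)) m := by
    refine Integrable.mono' (hiW.add hi2) ?_ ?_
    · exact (Real.measurable_log.comp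
        (((measurable_id.mul hPm).div_const N).const_add 1)).aestronglyMeasurable
    · filter_upwards [hpos, hb] with x hx hbx
      have : 0 ≤ x * P x / N := div_nonneg (mul_nonneg hx.le (hP0 x)) hN.le
      rw [Real.norm_of_nonneg (Real.log_nonneg (by linarith))]
      exact hbx
  have h2 : ∫ x, μ * (P x / N - max (1 / μ - 1 / x) 0) ∂m ≤ 0 := by
    rw [integral_const_mul, integral_sub (hPi.div_const N) (integrable_excess hpos hμ.1), hμ.2,
      integral_div]
    refine mul_nonpos_of_nonneg_of_nonpos hμ.1.le ?_
    rw [sub_nonpos, div_le_iff₀ hN]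
    exact hPs
  calc ∫ x, Real.log (1 + x * P x / N) ∂m
      ≤ ∫ x, (Real.log (1 + x * max (1 / μ - 1 / x) 0)
          + μ * (P x / N - max (1 / μ - 1 / x) 0)) ∂m := integral_mono_ae hi1 (hiW.add hi2) hb
    _ = fillRate m μ + ∫ x, μ * (P x / N - max (1 / μ - 1 / x) 0) ∂m := by
        rw [integral_add hiW hi2, integral_log_one_add_excess hpos hμ.1]
    _ ≤ fillRate m μ := by linarith

theorem ergodicCapacity_eq [IsFiniteMeasure m] (hpos : ∀ᵐ x ∂m, 0 < x)
    (hint : Integrable (fun x : ℝ => x) m) (k : ℕ) {N s μ : ℝ} (hN : 0 < N)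
    (hμ : IsThreshold m s μ) :
    ergodicCapacity m k (s * N) N = 1 / (k : ℝ) * fillRate m μ := by
  rw [ergodicCapacity, (isGreatest_averageRate_waterfilling hpos hint k hN hμ).csSup_eq,
    averageRate_waterfilling hpos k hN hμ.1]

/-- This is the tangent inequality with competitor p = 0, integrated. -/
theorem mul_fillPower_le_fillRate [IsFiniteMeasure m] (hpos : ∀ᵐ x ∂m, 0 < x)
    (hint : Integrable (fun x : ℝ => x) m) {μ : ℝ} (hμ : 0 < μ) :
    μ * fillPower m μ ≤ fillRate m μ := by
  rw [← integral_log_one_add_excess hpos hμ, fillPower, ← integral_const_mul]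
  refine integral_mono_ae ((integrable_excess hpos hμ).const_mul μ)
    (integrable_log_one_add_excess hpos hint hμ) ?_
  filter_upwards [hpos] with x hx
  have := log_le_excess_rate hμ hx le_rfl
  simp only [mul_zero, add_zero, Real.log_one, zero_sub, mul_neg] at this
  linarith

/-- The rate in the high-power regime. -/
theorem tendsto_fillRate_sub [IsProbabilityMeasure m] (hpos : ∀ᵐ x ∂m, 0 < x)
    (hint : Integrable (fun x : ℝ => x) m) (hlog : Integrable Real.log m) :
    Tendsto (fun μ => fillRate m μ - (∫ x, Real.log x ∂m - Real.log μ)) (𝓝[>] 0) (𝓝 0) := by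
  suffices h : Tendsto (fun μ => fillRate m μ - (∫ x, Real.log x ∂m - Real.log μ)) (𝓝[>] 0)
      (𝓝 (∫ _x, (0 : ℝ) ∂m)) by simpa using h
  have hev : ∀ᶠ μ : ℝ in 𝓝[>] 0,
      ∫ x, (Real.log (1 + x * max (1 / μ - 1 / x) 0) - (Real.log x - Real.log μ)) ∂m
        = fillRate m μ - (∫ x, Real.log x ∂m - Real.log μ) := by
    filter_upwards [self_mem_nhdsWithin] with μ hμ
    rw [integral_sub (integrable_log_one_add_excess hpos hint hμ)
      (show Integrable (fun x => Real.log x - Real.log μ) m from hlog.sub (integrable_const _)),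
      integral_sub hlog (integrable_const _), integral_log_one_add_excess hpos hμ]
    simp
  refine Tendsto.congr' hev ?_
  refine tendsto_integral_filter_of_dominated_convergence (fun x => |Real.log x|) ?_ ?_
    hlog.abs ?_
  · refine Eventually.of_forall fun μ => Measurable.aestronglyMeasurable ?_
    exact (Real.measurable_log.comp
      ((measurable_id.mul (measurable_excess μ)).const_add 1)).sub
      (Real.measurable_log.sub_const _)
  · filter_upwards [Ioo_mem_nhdsGT one_pos] with μ hμ
    filter_upwards [hpos] with x hx
    rw [log_one_add_excess hμ.1 hx]
    by_cases h : μ < x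
    · rw [Set.indicator_of_mem (Set.mem_Ioi.2 h), Real.log_div hx.ne' hμ.1.ne']
      simp
    -- For x ≤ μ < 1 the discrepancy is log μ - log x, at most -log x because log μ ≤ 0; for x > μ
    -- it vanishes.
    · rw [Set.indicator_of_notMem (by simpa using h), Real.norm_eq_abs, zero_sub, abs_neg]
      have h1 : Real.log x ≤ Real.log μ := Real.log_le_log hx (not_lt.1 h)
      have h2 : Real.log μ ≤ 0 := Real.log_nonpos hμ.1.le hμ.2.le
      rw [abs_of_nonpos (by linarith), abs_of_nonpos (by linarith)]
      linarith
  · filter_upwards [hpos] with x hx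
    refine tendsto_const_nhds.congr' ?_
    filter_upwards [Ioo_mem_nhdsGT hx] with μ hμ
    rw [log_one_add_excess hμ.1 hx, Set.indicator_of_mem (Set.mem_Ioi.2 hμ.2),
      Real.log_div hx.ne' hμ.1.ne', sub_self]

theorem tendsto_ergodicCapacity_sub_log [IsProbabilityMeasure m] (hpos : ∀ᵐ x ∂m, 0 < x)
    (hint : Integrable (fun x : ℝ => x) m) (hlog : Integrable Real.log m) (k : ℕ) {N : ℝ}
    (hN : 0 < N) :
    Tendsto (fun s => ergodicCapacity m k (s * N) N
      - 1 / (k : ℝ) * (Real.log s + ∫ x, Real.log x ∂m)) atTop (𝓝 0) := by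
  choose! μ hμ using fun (s : ℝ) (hs : 0 < s) => exists_fillPower_eq hpos hs
  have hlim : Tendsto μ atTop (𝓝[>] 0) := by
    refine tendsto_nhdsWithin_iff.2 ⟨?_, ?_⟩
    · refine tendsto_of_tendsto_of_tendsto_of_le_of_le' tendsto_const_nhds
        tendsto_inv_atTop_zero ?_ ?_
      · filter_upwards [eventually_gt_atTop 0] with s hs using (hμ s hs).1.le
      · filter_upwards [eventually_gt_atTop 0] with s hs
        have h1 := fillPower_le hpos (hμ s hs).1
        rw [(hμ s hs).2] at h1
        rw [← one_div, le_div_iff₀ hs]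
        rwa [le_div_iff₀ (hμ s hs).1, mul_comm] at h1
    · filter_upwards [eventually_gt_atTop 0] with s hs using (hμ s hs).1
  have h1 := (tendsto_fillRate_sub hpos hint hlog).comp hlim
  -- Since S(μ s) = s, this says log μ(s) + log s → 0, which trades -log μ for log s.
  have h2 : Tendsto (fun s => Real.log (μ s * fillPower m (μ s))) atTop (𝓝 (Real.log 1)) :=
    ((Real.continuousAt_log one_ne_zero).tendsto.comp (tendsto_mul_fillPower hpos)).comp hlim
  have h3 := (h1.sub h2).const_mul (1 / (k : ℝ))
  simp only [Real.log_one, sub_zero, mul_zero] at h3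
  refine h3.congr' ?_
  filter_upwards [eventually_gt_atTop 0] with s hs
  rw [ergodicCapacity_eq hpos hint k hN (μ := μ s) ⟨(hμ s hs).1, (hμ s hs).2⟩, (hμ s hs).2,
    Real.log_mul (hμ s hs).1.ne' hs.ne', Function.comp_apply]
  ring

end Fill

/-! ### Low-power asymptotics for gain laws with tail exp(-2√(cy)) to logarithmic precision. -/

section LowPower

variable {m : Measure ℝ} {c : ℝ}

theorem tendsto_sqrt_mul_atTop (hc : 0 < c) :
    Tendsto (fun μ : ℝ => Real.sqrt (c * μ)) atTop atTop :=
  Real.tendsto_sqrt_atTop.comp (tendsto_id.const_mul_atTop hc)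

theorem eventually_le_exp_mul_sqrt (hc : 0 < c) {r : ℝ} (hr : 0 < r) (K : ℝ) :
    ∀ᶠ μ : ℝ in atTop, K ≤ Real.exp (r * Real.sqrt (c * μ)) :=
  (Real.tendsto_exp_atTop.comp
    ((tendsto_sqrt_mul_atTop hc).const_mul_atTop hr)).eventually_ge_atTop K

theorem tendsto_log_div_sqrt_mul (hc : 0 < c) :
    Tendsto (fun μ : ℝ => Real.log μ / Real.sqrt (c * μ)) atTop (𝓝 0) := by
  have h := (isLittleO_log_rpow_atTop (r := 1 / 2) (by norm_num)).tendsto_div_nhds_zero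
  have h2 := h.const_mul (Real.sqrt c)⁻¹
  rw [mul_zero] at h2
  refine h2.congr fun μ => ?_
  rw [Real.sqrt_mul hc.le, ← Real.sqrt_eq_rpow, div_eq_mul_inv, div_eq_mul_inv, mul_inv]
  ring

/-- The bound t²/2 ≤ exp t at t = 2η√(cx); it lets a small loss in the exponent absorb a factor x.
-/
theorem le_const_mul_exp_sqrt (hc : 0 < c) {η x : ℝ} (hη : 0 < η) (hx : 0 ≤ x) :
    x ≤ 1 / (2 * η ^ 2 * c) * Real.exp (2 * η * Real.sqrt (c * x)) := by
  have h1 : 0 ≤ 2 * η * Real.sqrt (c * x) := by positivity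
  have h2 := Real.quadratic_le_exp_of_nonneg h1
  have h3 : (2 * η * Real.sqrt (c * x)) ^ 2 = 4 * η ^ 2 * (c * x) := by
    rw [mul_pow, Real.sq_sqrt (by positivity)]
    ring
  rw [h3] at h2
  rw [div_mul_eq_mul_div, one_mul, le_div_iff₀ (by positivity)]
  linarith

/-- Integrability of every `exp (2 θ √(c x))` with `θ < 1`. -/
def SqrtExpIntegrable (m : Measure ℝ) (c : ℝ) : Prop :=
  ∀ θ : ℝ, 0 < θ → θ < 1 → Integrable (fun x => Real.exp (2 * θ * Real.sqrt (c * x))) m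

/-- The tail of `m` decays at most like `exp (-2 √(c y))`, up to a factor `1 + ε` in the
exponent. -/
def SqrtExpTail (m : Measure ℝ) (c : ℝ) : Prop :=
  ∀ ε : ℝ, 0 < ε → ∀ᶠ y : ℝ in atTop,
    Real.exp (-(2 * (1 + ε) * Real.sqrt (c * y))) ≤ m.real (Set.Ioi y)

theorem SqrtExpTail.real_Ioi_pos [IsFiniteMeasure m] (h : SqrtExpTail m c) (y : ℝ) :
    0 < m.real (Set.Ioi y) := by
  obtain ⟨z, hz, hyz⟩ := ((h 1 one_pos).and (eventually_ge_atTop y)).exists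
  exact (Real.exp_pos _).trans_le (hz.trans (measureReal_mono (Set.Ioi_subset_Ioi hyz)))

theorem SqrtExpIntegrable.mul_exp (h : SqrtExpIntegrable m c) (hc : 0 < c)
    (hpos : ∀ᵐ x ∂m, 0 < x) {θ : ℝ} (hθ : 0 < θ) (hθ1 : θ < 1) :
    Integrable (fun x => x * Real.exp (2 * θ * Real.sqrt (c * x))) m := by
  have hη : 0 < (1 - θ) / 2 := by linarith
  refine Integrable.mono' ((h ((1 + θ) / 2) (by linarith) (by linarith)).const_mul
    (1 / (2 * ((1 - θ) / 2) ^ 2 * c))) (Measurable.aestronglyMeasurable (by fun_prop)) ?_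
  filter_upwards [hpos] with x hx
  rw [Real.norm_of_nonneg (by positivity)]
  calc x * Real.exp (2 * θ * Real.sqrt (c * x))
      ≤ 1 / (2 * ((1 - θ) / 2) ^ 2 * c) * Real.exp (2 * ((1 - θ) / 2) * Real.sqrt (c * x))
          * Real.exp (2 * θ * Real.sqrt (c * x)) :=
        mul_le_mul_of_nonneg_right (le_const_mul_exp_sqrt hc hη hx.le) (Real.exp_pos _).le
    _ = _ := by
        rw [mul_assoc, ← Real.exp_add]
        congr 2
        ring

theorem SqrtExpIntegrable.integrable_id (h : SqrtExpIntegrable m c) (hc : 0 < c)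
    (hpos : ∀ᵐ x ∂m, 0 < x) : Integrable (fun x => x) m := by
  refine Integrable.mono' (h.mul_exp hc hpos (θ := 1 / 2) (by norm_num) (by norm_num))
    measurable_id.aestronglyMeasurable ?_
  filter_upwards [hpos] with x hx
  rw [Real.norm_of_nonneg hx.le]
  exact le_mul_of_one_le_right hx.le (Real.one_le_exp (by positivity))

/-- Chernoff bound for the tail integral of a nonnegative function. -/
theorem setIntegral_Ioi_le_exp (hc : 0 < c) (hpos : ∀ᵐ x ∂m, 0 < x) {f : ℝ → ℝ}
    (hf : ∀ x, 0 < x → 0 ≤ f x) (hfi : Integrable f m) {θ : ℝ} (hθ : 0 < θ)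
    (hi : Integrable (fun x => f x * Real.exp (2 * θ * Real.sqrt (c * x))) m) (ν : ℝ) :
    ∫ x in Set.Ioi ν, f x ∂m ≤
      (∫ x, f x * Real.exp (2 * θ * Real.sqrt (c * x)) ∂m)
        * Real.exp (-(2 * θ * Real.sqrt (c * ν))) := by
  rw [← integral_indicator measurableSet_Ioi, ← integral_mul_const]
  refine integral_mono_ae (hfi.indicator measurableSet_Ioi) (hi.mul_const _) ?_
  filter_upwards [hpos] with x hx
  have h0 := hf x hx
  by_cases hx2 : x ∈ Set.Ioi ν
  · rw [Set.indicator_of_mem hx2, mul_assoc, ← Real.exp_add]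
    refine le_mul_of_one_le_right h0 (Real.one_le_exp ?_)
    have : Real.sqrt (c * ν) ≤ Real.sqrt (c * x) :=
      Real.sqrt_le_sqrt (mul_le_mul_of_nonneg_left (le_of_lt hx2) hc.le)
    have := mul_le_mul_of_nonneg_left this (show 0 ≤ 2 * θ by positivity)
    linarith
  · rw [Set.indicator_of_notMem hx2]
    positivity

theorem eventually_exp_le_mul_fillPower [IsFiniteMeasure m] (hc : 0 < c)
    (hpos : ∀ᵐ x ∂m, 0 < x) (ht : SqrtExpTail m c) {ε : ℝ} (hε : 0 < ε) :
    ∀ᶠ μ : ℝ in atTop,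
      Real.exp (-(2 * (1 + ε) * Real.sqrt (c * μ))) ≤ μ * fillPower m μ := by
  -- Chosen so that (1 + δ)² < 1 + ε. The tail is taken at κμ with κ = (1 + δ)²; the exponent left
  -- over absorbs the constant 1 - 1/κ.
  set δ := ε / (3 + ε) with hδ
  have hδ0 : 0 < δ := by positivity
  have hδ1 : δ < 1 := by
    rw [hδ, div_lt_one (by positivity)]
    linarith
  have hδ3 : 3 * δ < ε := by
    rw [hδ, mul_div_assoc', div_lt_iff₀ (by positivity)]
    nlinarith
  have hgap : 0 < 2 * (ε - (2 * δ + δ ^ 2)) := by nlinarith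
  set κ := (1 + δ) ^ 2 with hκ
  have hκ1 : 1 < κ := by
    rw [hκ]
    nlinarith
  have hκ0 : 0 < κ := by positivity
  have hq : 0 < 1 - 1 / κ := by
    have := (div_lt_one hκ0).2 hκ1
    linarith
  filter_upwards [eventually_gt_atTop 0,
    (tendsto_id.const_mul_atTop hκ0).eventually (ht δ hδ0),
    eventually_le_exp_mul_sqrt hc hgap (1 / (1 - 1 / κ))] with μ hμ h1 h2
  have hsq : Real.sqrt (c * (κ * μ)) = (1 + δ) * Real.sqrt (c * μ) := by
    rw [show c * (κ * μ) = (1 + δ) ^ 2 * (c * μ) by rw [hκ]; ring, Real.sqrt_mul (by positivity),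
      Real.sqrt_sq (by positivity)]
  simp only [id_eq, hsq] at h1
  rw [div_le_iff₀ hq] at h2
  have h3 := fillPower_ge hpos hμ hκ1
  calc Real.exp (-(2 * (1 + ε) * Real.sqrt (c * μ)))
      ≤ Real.exp (-(2 * (1 + ε) * Real.sqrt (c * μ))) *
        (Real.exp (2 * (ε - (2 * δ + δ ^ 2)) * Real.sqrt (c * μ)) * (1 - 1 / κ)) :=
        le_mul_of_one_le_right (Real.exp_pos _).le h2
    _ = (1 - 1 / κ) * Real.exp (-(2 * (1 + δ) * ((1 + δ) * Real.sqrt (c * μ)))) := by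
        rw [← mul_assoc, ← Real.exp_add, mul_comm]
        congr 2
        ring
    _ ≤ (1 - 1 / κ) * m.real (Set.Ioi (κ * μ)) := mul_le_mul_of_nonneg_left h1 hq.le
    _ = μ * ((1 / μ) * (1 - 1 / κ) * m.real (Set.Ioi (κ * μ))) := by
        field_simp
    _ ≤ μ * fillPower m μ := mul_le_mul_of_nonneg_left h3 hμ.le

theorem mul_fillPower_le_real_Ioi [IsFiniteMeasure m] (hpos : ∀ᵐ x ∂m, 0 < x) {μ : ℝ}
    (hμ : 0 < μ) : μ * fillPower m μ ≤ ∫ _x in Set.Ioi μ, (1 : ℝ) ∂m := by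
  rw [fillPower, ← integral_const_mul, ← integral_indicator measurableSet_Ioi]
  refine integral_mono_ae ((integrable_excess hpos hμ).const_mul μ)
    ((integrable_const _).indicator measurableSet_Ioi) ?_
  filter_upwards [hpos] with x hx
  by_cases h : x ∈ Set.Ioi μ
  · rw [Set.indicator_of_mem h]
    calc μ * max (1 / μ - 1 / x) 0 ≤ μ * (1 / μ) :=
          mul_le_mul_of_nonneg_left (excess_le hμ hx) hμ.le
      _ = 1 := by field_simp
  · rw [Set.indicator_of_notMem h, max_eq_right, mul_zero]
    have := one_div_le_one_div_of_le hx (not_lt.1 h)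
    linarith

/-- The logarithm of the power spent decays like `-2 √(c μ)`. -/
theorem tendsto_log_fillPower_div [IsProbabilityMeasure m] (hc : 0 < c)
    (hpos : ∀ᵐ x ∂m, 0 < x) (he : SqrtExpIntegrable m c) (ht : SqrtExpTail m c) :
    Tendsto (fun μ => Real.log (1 / fillPower m μ) / Real.sqrt (c * μ)) atTop (𝓝 2) := by
  have hφ := tendsto_sqrt_mul_atTop hc
  refine tendsto_order.2 ⟨fun r hr => ?_, fun r hr => ?_⟩
  -- θ lies strictly between r/2 and 1; the maximum with 0 keeps it positive when r is negative.
  · set θ := (max (r / 2) 0 + 1) / 2 with hθ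
    have h0 : 0 ≤ max (r / 2) 0 := le_max_right _ _
    have hr2 : r / 2 ≤ max (r / 2) 0 := le_max_left _ _
    have h1 : max (r / 2) 0 < 1 := max_lt (by linarith) one_pos
    have hθ0 : 0 < θ := by linarith
    have hθ1 : θ < 1 := by linarith
    have hθr : r < 2 * θ := by linarith
    have hi := he θ hθ0 hθ1
    set M := ∫ x, (1 : ℝ) * Real.exp (2 * θ * Real.sqrt (c * x)) ∂m with hM
    have hlim : Tendsto (fun μ => 2 * θ - Real.log M / Real.sqrt (c * μ)) atTop
        (𝓝 (2 * θ - 0)) := tendsto_const_nhds.sub (tendsto_const_nhds.div_atTop hφ)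
    rw [sub_zero] at hlim
    filter_upwards [hlim.eventually (lt_mem_nhds hθr), eventually_ge_atTop 1,
      hφ.eventually_gt_atTop 0] with μ h2 hμ hφμ
    refine h2.trans_le ?_
    have hμ0 : 0 < μ := by linarith
    have hS : 0 < fillPower m μ := fillPower_pos hpos ht.real_Ioi_pos hμ0
    have h3 : fillPower m μ ≤ M * Real.exp (-(2 * θ * Real.sqrt (c * μ))) :=
      calc fillPower m μ ≤ μ * fillPower m μ := le_mul_of_one_le_left hS.le hμ
        _ ≤ ∫ _x in Set.Ioi μ, (1 : ℝ) ∂m := mul_fillPower_le_real_Ioi hpos hμ0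
        _ ≤ _ := setIntegral_Ioi_le_exp hc hpos (fun _ _ => zero_le_one) (integrable_const _)
            hθ0 (by simpa using hi) μ
    have hMpos : 0 < M := by
      by_contra! hcon
      have := mul_nonpos_of_nonpos_of_nonneg hcon
        (Real.exp_pos (-(2 * θ * Real.sqrt (c * μ)))).le
      linarith
    have h4 := Real.log_le_log hS h3
    rw [Real.log_mul hMpos.ne' (Real.exp_pos _).ne', Real.log_exp] at h4
    rw [one_div, Real.log_inv, le_div_iff₀ hφμ, sub_mul, div_mul_cancel₀ _ hφμ.ne']
    linarith
  · set ε := (r - 2) / 4 with hε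
    have hε0 : 0 < ε := by linarith
    -- The lower bound is for μ S(μ); the factor μ costs only log μ = o(√μ).
    have hlim : Tendsto (fun μ => 2 * (1 + ε) + Real.log μ / Real.sqrt (c * μ)) atTop
        (𝓝 (2 * (1 + ε) + 0)) := tendsto_const_nhds.add (tendsto_log_div_sqrt_mul hc)
    rw [add_zero] at hlim
    filter_upwards [hlim.eventually (gt_mem_nhds (show 2 * (1 + ε) < r by linarith)),
      eventually_gt_atTop 0, hφ.eventually_gt_atTop 0,
      eventually_exp_le_mul_fillPower hc hpos ht hε0] with μ h2 hμ0 hφμ h3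
    refine lt_of_le_of_lt ?_ h2
    have hS : 0 < fillPower m μ := fillPower_pos hpos ht.real_Ioi_pos hμ0
    have h4 := Real.log_le_log (Real.exp_pos _) h3
    rw [Real.log_mul hμ0.ne' hS.ne', Real.log_exp] at h4
    rw [one_div, Real.log_inv, div_le_iff₀ hφμ, add_mul, div_mul_cancel₀ _ hφμ.ne']
    linarith

/-- With t = x/μ, log t ≤ t - 1 = t(1 - 1/t), which is at most (1 + δ)(1 - 1/t) when t ≤ 1 + δ.
Beyond that, log t ≤ x suffices, as μ ≥ 1. -/
theorem fillRate_le [IsFiniteMeasure m] (hpos : ∀ᵐ x ∂m, 0 < x)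
    (hint : Integrable (fun x : ℝ => x) m) {μ δ : ℝ} (hμ : 1 ≤ μ) (hδ : 0 < δ) :
    fillRate m μ ≤ (1 + δ) * (μ * fillPower m μ) + ∫ x in Set.Ioi ((1 + δ) * μ), x ∂m := by
  have hμ0 : 0 < μ := by linarith
  rw [← integral_log_one_add_excess hpos hμ0, fillPower, ← integral_const_mul,
    ← integral_const_mul, ← integral_indicator measurableSet_Ioi,
    ← integral_add (((integrable_excess hpos hμ0).const_mul μ).const_mul _)
      (hint.indicator measurableSet_Ioi)]
  refine integral_mono_ae (integrable_log_one_add_excess hpos hint hμ0)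
    ((((integrable_excess hpos hμ0).const_mul μ).const_mul _).add
      (hint.indicator measurableSet_Ioi)) ?_
  filter_upwards [hpos] with x hx
  have hE : 0 ≤ max (1 / μ - 1 / x) 0 := le_max_right _ _
  have hI : 0 ≤ (Set.Ioi ((1 + δ) * μ)).indicator (fun x => x) x :=
    Set.indicator_apply_nonneg fun _ => hx.le
  have hE' : 0 ≤ (1 + δ) * (μ * max (1 / μ - 1 / x) 0) := by positivity
  rw [log_one_add_excess hμ0 hx]
  by_cases h : x ∈ Set.Ioi μ
  · rw [Set.indicator_of_mem h]
    have hxm : μ < x := h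
    have hlog := Real.log_le_sub_one_of_pos (div_pos hx hμ0)
    by_cases h2 : x ∈ Set.Ioi ((1 + δ) * μ)
    · rw [Set.indicator_of_mem h2]
      have : x / μ ≤ x := div_le_self hx.le hμ
      linarith
    · have h3 : x ≤ (1 + δ) * μ := not_lt.1 h2
      have h4 : x / μ ≤ 1 + δ := by rwa [div_le_iff₀ hμ0]
      have h5 : 1 / μ - 1 / x ≤ max (1 / μ - 1 / x) 0 := le_max_left _ _
      have h6 : 0 ≤ μ * (1 / μ - 1 / x) := by
        have := one_div_le_one_div_of_le hμ0 hxm.le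
        exact mul_nonneg hμ0.le (by linarith)
      have h7 : x / μ - 1 = x / μ * (μ * (1 / μ - 1 / x)) := by
        field_simp
      have h8 : x / μ * (μ * (1 / μ - 1 / x)) ≤ (1 + δ) * (μ * (1 / μ - 1 / x)) :=
        mul_le_mul_of_nonneg_right h4 h6
      have h9 : (1 + δ) * (μ * (1 / μ - 1 / x)) ≤ (1 + δ) * (μ * max (1 / μ - 1 / x) 0) :=
        mul_le_mul_of_nonneg_left (mul_le_mul_of_nonneg_left h5 hμ0.le) (by linarith)
      linarith
  · rw [Set.indicator_of_notMem h]
    exact add_nonneg hE' hI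

theorem tendsto_fillRate_div [IsProbabilityMeasure m] (hc : 0 < c)
    (hpos : ∀ᵐ x ∂m, 0 < x) (he : SqrtExpIntegrable m c) (ht : SqrtExpTail m c) :
    Tendsto (fun μ => fillRate m μ / (μ * fillPower m μ)) atTop (𝓝 1) := by
  have hφ := tendsto_sqrt_mul_atTop hc
  have hint := he.integrable_id hc hpos
  refine tendsto_order.2 ⟨fun r hr => ?_, fun r hr => ?_⟩
  · filter_upwards [eventually_gt_atTop 0] with μ hμ
    have hS : 0 < fillPower m μ := fillPower_pos hpos ht.real_Ioi_pos hμ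
    refine hr.trans_le ?_
    rw [one_le_div (by positivity)]
    exact mul_fillPower_le_fillRate hpos hint hμ
  · set δ := (r - 1) / 2 with hδ
    have hδ0 : 0 < δ := by linarith
    set κ := Real.sqrt (1 + δ) with hκ
    have hκ1 : 1 < κ := by
      rw [hκ, Real.lt_sqrt zero_le_one]
      linarith
    have hκ0 : 0 < κ := by linarith
    -- The Chernoff exponent must satisfy θ < 1 and yet θκ > 1, so that the tail beyond (1 + δ)μ =
    -- κ²μ is exponentially smaller than μ S(μ). Here θκ = 1 + 2ε against the lower bound's 1 + ε.
    set θ := (1 / κ + 1) / 2 with hθ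
    have hκi : 1 / κ < 1 := (div_lt_one hκ0).2 hκ1
    have hκi0 : 0 < 1 / κ := by positivity
    have hθ0 : 0 < θ := by linarith
    have hθ1 : θ < 1 := by linarith
    set ε := (κ - 1) / 4 with hε
    have hε0 : 0 < ε := by linarith
    have hθκ : θ * κ = 1 + 2 * ε := by
      rw [hθ, hε]
      field_simp
      ring
    have hi := he.mul_exp hc hpos hθ0 hθ1
    set K := ∫ x, x * Real.exp (2 * θ * Real.sqrt (c * x)) ∂m with hK
    filter_upwards [eventually_ge_atTop 1, eventually_exp_le_mul_fillPower hc hpos ht hε0,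
      eventually_le_exp_mul_sqrt hc (show 0 < 2 * ε by linarith) (2 * K / δ)] with μ hμ h1 h2
    have hμ0 : 0 < μ := by linarith
    have hS : 0 < fillPower m μ := fillPower_pos hpos ht.real_Ioi_pos hμ0
    have hsq : Real.sqrt (c * ((1 + δ) * μ)) = κ * Real.sqrt (c * μ) := by
      rw [show c * ((1 + δ) * μ) = (1 + δ) * (c * μ) by ring, Real.sqrt_mul (by positivity)]
    have h3 := fillRate_le hpos hint hμ hδ0
    have h4 := setIntegral_Ioi_le_exp hc hpos (f := fun x => x) (fun x hx => hx.le) hint hθ0 hi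
      ((1 + δ) * μ)
    rw [← hK, hsq] at h4
    have h5 : K * Real.exp (-(2 * θ * (κ * Real.sqrt (c * μ))))
        ≤ δ / 2 * (μ * fillPower m μ) := by
      rw [div_le_iff₀ hδ0] at h2
      calc K * Real.exp (-(2 * θ * (κ * Real.sqrt (c * μ))))
          ≤ (δ / 2 * Real.exp (2 * ε * Real.sqrt (c * μ)))
              * Real.exp (-(2 * θ * (κ * Real.sqrt (c * μ)))) :=
            mul_le_mul_of_nonneg_right (by linarith) (Real.exp_pos _).le
        _ = δ / 2 * Real.exp (-(2 * (1 + ε) * Real.sqrt (c * μ))) := by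
            rw [mul_assoc, ← Real.exp_add]
            congr 2
            rw [show 2 * θ * (κ * Real.sqrt (c * μ)) = 2 * (θ * κ) * Real.sqrt (c * μ) by ring,
              hθκ]
            ring
        _ ≤ _ := mul_le_mul_of_nonneg_left h1 (by linarith)
    have hP : 0 < μ * fillPower m μ := by positivity
    rw [div_lt_iff₀ hP]
    -- The near part contributes 1 + δ and the far part δ/2, in total below 1 + 2δ.
    have hr' : r = 1 + 2 * δ := by linarith
    have : 0 < δ / 2 * (μ * fillPower m μ) := by positivity
    rw [hr']
    nlinarith

theorem isEquivalent_fillRate [IsProbabilityMeasure m] (hc : 0 < c)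
    (hpos : ∀ᵐ x ∂m, 0 < x) (he : SqrtExpIntegrable m c) (ht : SqrtExpTail m c) :
    fillRate m ~[atTop] fun μ =>
      1 / (4 * c) * fillPower m μ * Real.log (1 / fillPower m μ) ^ 2 := by
  have h1 := tendsto_fillRate_div hc hpos he ht
  have h2 := tendsto_log_fillPower_div hc hpos he ht
  -- Multiplying R/(μS) by 4cμ/log²(1/S), each of limit 1, eliminates μ.
  have h3 := h1.mul ((tendsto_const_nhds (x := (4 : ℝ))).div (h2.pow 2) (by norm_num))
  rw [show (1 : ℝ) * (4 / 2 ^ 2) = 1 by norm_num] at h3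
  refine isEquivalent_of_tendsto_one (h3.congr' ?_)
  filter_upwards [eventually_gt_atTop 0, h2.eventually (lt_mem_nhds two_pos)] with μ hμ h4
  have hS : 0 < fillPower m μ := fillPower_pos hpos ht.real_Ioi_pos hμ
  have hφ : 0 < Real.sqrt (c * μ) := Real.sqrt_pos.2 (by positivity)
  have hL : 0 < Real.log (1 / fillPower m μ) := by
    by_contra! hcon
    have := div_nonpos_of_nonpos_of_nonneg hcon hφ.le
    linarith
  simp only [Pi.div_apply]
  rw [div_pow, Real.sq_sqrt (by positivity)]
  field_simp

theorem isEquivalent_ergodicCapacity [IsProbabilityMeasure m] (hc : 0 < c)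
    (hpos : ∀ᵐ x ∂m, 0 < x) (he : SqrtExpIntegrable m c) (ht : SqrtExpTail m c) (k : ℕ)
    {N : ℝ} (hN : 0 < N) :
    (fun s : ℝ => ergodicCapacity m k (s * N) N) ~[𝓝[>] 0]
      fun s : ℝ => 1 / (k : ℝ) * (1 / (4 * c) * s * Real.log (1 / s) ^ 2) := by
  choose! μ hμ using fun (s : ℝ) (hs : 0 < s) => exists_fillPower_eq hpos hs
  -- As S is positive and strictly decreasing, s < S(B) forces the threshold of s above B.
  have hlim : Tendsto μ (𝓝[>] 0) atTop := by
    refine tendsto_atTop.2 fun B => ?_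
    have hB : 0 < max B 1 := lt_max_of_lt_right one_pos
    filter_upwards [Ioo_mem_nhdsGT (fillPower_pos hpos ht.real_Ioi_pos hB)] with s hs
    by_contra! hcon
    have := (strictAntiOn_fillPower hpos ht.real_Ioi_pos) (hμ s hs.1).1 hB
      (hcon.trans_le (le_max_left _ _))
    rw [(hμ s hs.1).2] at this
    exact lt_asymm this hs.2
  have h := (IsEquivalent.refl (u := fun _ : ℝ => 1 / (k : ℝ)) (l := atTop)).mul
    (isEquivalent_fillRate hc hpos he ht)
  have h2 := h.comp_tendsto hlim
  refine (h2.congr_left ?_).congr_right ?_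
  · filter_upwards [self_mem_nhdsWithin] with s hs
    have hs' : 0 < s := hs
    exact (ergodicCapacity_eq hpos (he.integrable_id hc hpos) k hN (μ := μ s)
      ⟨(hμ s hs').1, (hμ s hs').2⟩).symm
  · filter_upwards [self_mem_nhdsWithin] with s hs
    have hs' : 0 < s := hs
    simp only [Function.comp_apply, Pi.mul_apply, (hμ s hs').2]

end LowPower

open ProbabilityTheory

/-! ### Integration against real-valued densities. -/

section Density

variable {α : Type*} [MeasurableSpace α] {μ : Measure α} {φ : α → ℝ}

theorem integrable_withDensity_ofReal_iff (hφ : Measurable φ) (h0 : 0 ≤ᵐ[μ] φ) {g : α → ℝ} :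
    Integrable g (μ.withDensity fun x => ENNReal.ofReal (φ x))
      ↔ Integrable (fun x => φ x * g x) μ := by
  rw [integrable_withDensity_iff_integrable_smul' hφ.ennreal_ofReal
    (Eventually.of_forall fun _ => ENNReal.ofReal_lt_top)]
  refine integrable_congr ?_
  filter_upwards [h0] with x hx
  rw [ENNReal.toReal_ofReal hx, smul_eq_mul]

theorem integral_withDensity_ofReal (hφ : Measurable φ) (h0 : 0 ≤ᵐ[μ] φ) (g : α → ℝ) :
    ∫ x, g x ∂(μ.withDensity fun x => ENNReal.ofReal (φ x)) = ∫ x, φ x * g x ∂μ := by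
  rw [integral_withDensity_eq_integral_toReal_smul hφ.ennreal_ofReal
    (Eventually.of_forall fun _ => ENNReal.ofReal_lt_top)]
  refine integral_congr_ae ?_
  filter_upwards [h0] with x hx
  rw [ENNReal.toReal_ofReal hx, smul_eq_mul]

theorem isProbabilityMeasure_withDensity_ofReal (hi : Integrable φ μ)
    (h0 : 0 ≤ᵐ[μ] φ) (h1 : ∫ x, φ x ∂μ = 1) :
    IsProbabilityMeasure (μ.withDensity fun x => ENNReal.ofReal (φ x)) := by
  refine ⟨?_⟩
  rw [withDensity_apply _ MeasurableSet.univ, Measure.restrict_univ,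
    ← ofReal_integral_eq_lintegral_ofReal hi h0, h1, ENNReal.ofReal_one]

end Density

/-- Apply log y ≤ y^ε/ε to both x and 1/x; integrability of logarithms then reduces to shifting a
power exponent by ±ε. -/
theorem abs_log_le_rpow_add_rpow {x ε : ℝ} (hx : 0 < x) (hε : 0 < ε) :
    |Real.log x| ≤ (x ^ ε + x ^ (-ε)) / ε := by
  have h1 := Real.log_le_rpow_div hx.le hε
  have h2 := Real.log_le_rpow_div (inv_nonneg.2 hx.le) hε
  rw [Real.log_inv, Real.inv_rpow hx.le, ← Real.rpow_neg hx.le] at h2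
  have h3 : 0 ≤ x ^ ε / ε := by positivity
  have h4 : 0 ≤ x ^ (-ε) / ε := by positivity
  rw [add_div, abs_le]
  constructor <;> linarith

/-! ### Gamma law: exponential moments, mean logarithm, tail. -/

section GammaMeasure

theorem gammaMeasure_one_eq (a : ℝ) :
    gammaMeasure a 1 = (volume.restrict (Set.Ioi 0)).withDensity
      fun x => ENNReal.ofReal ((Real.Gamma a)⁻¹ * (Real.exp (-x) * x ^ (a - 1))) := by
  rw [← withDensity_indicator measurableSet_Ioi, gammaMeasure]
  refine withDensity_congr_ae ?_
  filter_upwards [Measure.ae_ne volume (0 : ℝ)] with x hx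
  rcases lt_or_gt_of_ne hx with h | h
  · rw [gammaPDF_of_neg h, Set.indicator_of_notMem (by simpa using h.le)]
  · rw [gammaPDF_of_nonneg h.le, Set.indicator_of_mem (Set.mem_Ioi.2 h)]
    congr 1
    rw [Real.one_rpow, one_mul]
    ring

variable {a : ℝ}

theorem measurable_gammaDensity (a : ℝ) :
    Measurable fun x : ℝ => (Real.Gamma a)⁻¹ * (Real.exp (-x) * x ^ (a - 1)) := by
  fun_prop

theorem gammaDensity_nonneg (ha : 0 < a) : 0 ≤ᵐ[volume.restrict (Set.Ioi (0 : ℝ))]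
    fun x : ℝ => (Real.Gamma a)⁻¹ * (Real.exp (-x) * x ^ (a - 1)) := by
  filter_upwards [ae_restrict_mem measurableSet_Ioi] with x hx
  have := Real.Gamma_pos_of_pos ha
  have hx' : 0 < x := hx
  simp only [Pi.zero_apply]
  positivity

theorem integrable_gammaMeasure_one_iff (ha : 0 < a) {g : ℝ → ℝ} :
    Integrable g (gammaMeasure a 1) ↔
      IntegrableOn (fun x => Real.exp (-x) * x ^ (a - 1) * g x) (Set.Ioi 0) := by
  rw [gammaMeasure_one_eq, integrable_withDensity_ofReal_iff (measurable_gammaDensity a)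
    (gammaDensity_nonneg ha)]
  simp_rw [mul_assoc (Real.Gamma a)⁻¹]
  have h : IsUnit (Real.Gamma a)⁻¹ := (inv_ne_zero (Real.Gamma_pos_of_pos ha).ne').isUnit
  exact integrable_const_mul_iff h _

theorem integral_gammaMeasure_one (ha : 0 < a) (g : ℝ → ℝ) :
    ∫ x, g x ∂(gammaMeasure a 1) =
      (Real.Gamma a)⁻¹ * ∫ x in Set.Ioi 0, Real.exp (-x) * x ^ (a - 1) * g x := by
  rw [gammaMeasure_one_eq, integral_withDensity_ofReal (measurable_gammaDensity a)
    (gammaDensity_nonneg ha), ← integral_const_mul]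
  simp_rw [mul_assoc]

theorem ae_pos_gammaMeasure_one (a : ℝ) : ∀ᵐ x ∂(gammaMeasure a 1), 0 < x := by
  rw [gammaMeasure_one_eq]
  exact (withDensity_absolutelyContinuous _ _).ae_le (ae_restrict_mem measurableSet_Ioi)

theorem integrable_exp_gammaMeasure_one (ha : 0 < a) {θ : ℝ} (hθ : θ < 1) :
    Integrable (fun x => Real.exp (θ * x)) (gammaMeasure a 1) := by
  rw [integrable_gammaMeasure_one_iff ha]
  refine (integrableOn_rpow_mul_exp_neg_mul_rpow (s := a - 1) (p := 1) (b := 1 - θ)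
    (by linarith) one_pos (by linarith)).congr_fun (fun x _ => ?_) measurableSet_Ioi
  simp only [Real.rpow_one]
  rw [mul_right_comm, ← Real.exp_add, mul_comm]
  congr 2
  ring

theorem integrable_log_gammaMeasure_one (ha : 0 < a) :
    Integrable Real.log (gammaMeasure a 1) := by
  rw [integrable_gammaMeasure_one_iff ha]
  have h1 := Real.GammaIntegral_convergent (show 0 < a + a / 2 by linarith)
  have h2 := Real.GammaIntegral_convergent (show 0 < a - a / 2 by linarith)
  refine Integrable.mono' ((h1.add h2).const_mul (1 / (a / 2)))
    (Measurable.aestronglyMeasurable (by fun_prop)) ?_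
  filter_upwards [ae_restrict_mem measurableSet_Ioi] with x hx
  have hx' : 0 < x := hx
  rw [norm_mul, Real.norm_eq_abs (Real.log x), Real.norm_of_nonneg (by positivity)]
  calc Real.exp (-x) * x ^ (a - 1) * |Real.log x|
      ≤ Real.exp (-x) * x ^ (a - 1) * ((x ^ (a / 2) + x ^ (-(a / 2))) / (a / 2)) :=
        mul_le_mul_of_nonneg_left (abs_log_le_rpow_add_rpow hx' (by linarith)) (by positivity)
    _ = _ := by
        simp only [Pi.add_apply]
        rw [show a + a / 2 - 1 = (a - 1) + a / 2 by ring,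
          show a - a / 2 - 1 = (a - 1) + -(a / 2) by ring, Real.rpow_add hx', Real.rpow_add hx']
        ring

/-- Differentiating Euler's integral under the integral sign gives Γ'(a) as the integral of log t
against exp(-t) t^(a-1); the normalization divides by Γ(a). -/
theorem integral_log_gammaMeasure_one (ha : 0 < a) :
    ∫ x, Real.log x ∂(gammaMeasure a 1) = psi a := by
  have hre : 0 < (a : ℂ).re := by simpa using ha
  have hev : Complex.Gamma =ᶠ[𝓝 (a : ℂ)] Complex.GammaIntegral := by
    filter_upwards [(isOpen_lt continuous_const Complex.continuous_re).mem_nhds hre] with s hs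
      using Complex.Gamma_eq_integral hs
  have hd := ((Complex.hasDerivAt_GammaIntegral hre).congr_of_eventuallyEq hev).deriv
  have hI : ∫ t : ℝ in Set.Ioi 0, (t : ℂ) ^ ((a : ℂ) - 1) * (Real.log t * Real.exp (-t))
      = ((∫ x in Set.Ioi 0, Real.exp (-x) * x ^ (a - 1) * Real.log x : ℝ) : ℂ) := by
    rw [← integral_complex_ofReal]
    refine setIntegral_congr_fun measurableSet_Ioi fun t ht => ?_
    have ht' : 0 < t := ht
    push_cast [Complex.ofReal_cpow ht'.le]
    ring
  rw [integral_gammaMeasure_one ha, psi, Complex.digamma_def, logDeriv_apply, hd, hI,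
    Complex.Gamma_ofReal, ← Complex.ofReal_div, Complex.ofReal_re, div_eq_inv_mul]

/-- Far out, the gamma density dominates κ exp(-κx), whose tail integral is exactly exp(-κr). -/
theorem eventually_exp_le_gammaMeasure_one (ha : 0 < a) {κ : ℝ} (hκ : 1 < κ) :
    ∀ᶠ r : ℝ in atTop, Real.exp (-(κ * r)) ≤ (gammaMeasure a 1).real (Set.Ioi r) := by
  have hκ0 : 0 < κ := by linarith
  have hΓ := Real.Gamma_pos_of_pos ha
  obtain ⟨R, hR⟩ := eventually_atTop.1 ((tendsto_exp_mul_div_rpow_atTop (1 - a) (κ - 1)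
    (by linarith)).eventually_ge_atTop (κ * Real.Gamma a))
  filter_upwards [eventually_ge_atTop (max R 0)] with r hr
  have hrR : R ≤ r := (le_max_left _ _).trans hr
  have hr0 : 0 ≤ r := (le_max_right _ _).trans hr
  have hint : IntegrableOn (fun x => (Real.Gamma a)⁻¹ * (Real.exp (-x) * x ^ (a - 1)))
      (Set.Ioi r) :=
    IntegrableOn.mono_set ((Real.GammaIntegral_convergent ha).const_mul _)
      (Set.Ioi_subset_Ioi hr0)
  have hval : (gammaMeasure a 1).real (Set.Ioi r)
      = ∫ x in Set.Ioi r, (Real.Gamma a)⁻¹ * (Real.exp (-x) * x ^ (a - 1)) := by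
    rw [gammaMeasure_one_eq, measureReal_def, withDensity_apply _ measurableSet_Ioi,
      Measure.restrict_restrict measurableSet_Ioi, Set.Ioi_inter_Ioi, sup_eq_left.2 hr0,
      ← ofReal_integral_eq_lintegral_ofReal hint, ENNReal.toReal_ofReal]
    · refine setIntegral_nonneg measurableSet_Ioi fun x hx => ?_
      have hx0 : 0 < x := hr0.trans_lt hx
      positivity
    · filter_upwards [ae_restrict_mem measurableSet_Ioi] with x hx
      have hx0 : 0 < x := hr0.trans_lt hx
      simp only [Pi.zero_apply]
      positivity
  have hneg : -κ < 0 := by linarith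
  rw [hval]
  calc Real.exp (-(κ * r)) = ∫ x in Set.Ioi r, κ * Real.exp (-κ * x) := by
        rw [integral_const_mul, integral_exp_mul_Ioi hneg]
        field_simp
    _ ≤ _ := by
        refine setIntegral_mono_on ((integrableOn_exp_mul_Ioi hneg r).const_mul κ) hint
          measurableSet_Ioi fun x hx => ?_
        have hx0 : 0 < x := hr0.trans_lt hx
        have h := hR x (hrR.trans (le_of_lt hx))
        have e1 : Real.exp ((κ - 1) * x) / x ^ (1 - a) = Real.exp (κ * x) * Real.exp (-x)
            * x ^ (a - 1) := by
          rw [← Real.exp_add, show a - 1 = -(1 - a) by ring, Real.rpow_neg hx0.le,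
            div_eq_mul_inv]
          congr 2
          ring
        rw [e1] at h
        have e2 : Real.exp (κ * x) * Real.exp (-κ * x) = 1 := by
          rw [← Real.exp_add]
          simp
        rw [inv_mul_eq_div, le_div_iff₀ hΓ]
        calc κ * Real.exp (-κ * x) * Real.Gamma a
            = κ * Real.Gamma a * Real.exp (-κ * x) := by ring
          _ ≤ Real.exp (κ * x) * Real.exp (-x) * x ^ (a - 1) * Real.exp (-κ * x) :=
              mul_le_mul_of_nonneg_right h (Real.exp_pos _).le
          _ = Real.exp (κ * x) * Real.exp (-κ * x) * (Real.exp (-x) * x ^ (a - 1)) := by ring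
          _ = _ := by rw [e2, one_mul]

end GammaMeasure

/-! ### Pointing-error law: normalization, mean logarithm, mass near `A`. -/

section PointingLaw

variable {A p : ℝ}

theorem integrableOn_rpow_Ioc (hA : 0 < A) (hp : 0 < p) :
    IntegrableOn (fun x : ℝ => x ^ (p - 1)) (Set.Ioc 0 A) := by
  rw [← intervalIntegrable_iff_integrableOn_Ioc_of_le hA.le]
  exact intervalIntegral.intervalIntegrable_rpow' (by linarith)

theorem integral_rpow_Ioc (hA : 0 < A) (hp : 0 < p) :
    ∫ x in Set.Ioc 0 A, x ^ (p - 1) = A ^ p / p := by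
  rw [← intervalIntegral.integral_of_le hA.le, integral_rpow (Or.inl (by linarith)),
    sub_add_cancel, Real.zero_rpow hp.ne', sub_zero]

theorem integrableOn_rpow_mul_log_Ioc (hA : 0 < A) (hp : 0 < p) :
    IntegrableOn (fun x : ℝ => x ^ (p - 1) * Real.log x) (Set.Ioc 0 A) := by
  have h1 := integrableOn_rpow_Ioc hA (show 0 < p + p / 2 by linarith)
  have h2 := integrableOn_rpow_Ioc hA (show 0 < p - p / 2 by linarith)
  refine Integrable.mono' ((h1.add h2).const_mul (1 / (p / 2)))
    (Measurable.aestronglyMeasurable (by fun_prop)) ?_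
  filter_upwards [ae_restrict_mem measurableSet_Ioc] with x hx
  have hx' : 0 < x := hx.1
  rw [norm_mul, Real.norm_eq_abs (Real.log x), Real.norm_of_nonneg (by positivity)]
  calc x ^ (p - 1) * |Real.log x|
      ≤ x ^ (p - 1) * ((x ^ (p / 2) + x ^ (-(p / 2))) / (p / 2)) :=
        mul_le_mul_of_nonneg_left (abs_log_le_rpow_add_rpow hx' (by linarith)) (by positivity)
    _ = _ := by
        simp only [Pi.add_apply]
        rw [show p + p / 2 - 1 = (p - 1) + p / 2 by ring,
          show p - p / 2 - 1 = (p - 1) + -(p / 2) by ring, Real.rpow_add hx', Real.rpow_add hx']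
        ring

theorem integral_rpow_mul_log_Ioc (hA : 0 < A) (hp : 0 < p) :
    ∫ x in Set.Ioc 0 A, x ^ (p - 1) * Real.log x = A ^ p / p * (Real.log A - 1 / p) := by
  rw [← intervalIntegral.integral_of_le hA.le]
  have hder : ∀ x : ℝ, 0 < x → HasDerivAt
      (fun x => (Real.log x * x ^ p) / p - x ^ p / p ^ 2) (x ^ (p - 1) * Real.log x) x := by
    intro x hx
    have h1 := Real.hasDerivAt_log hx.ne'
    have h2 := Real.hasDerivAt_rpow_const (p := p) (Or.inl hx.ne')
    refine (((h1.mul h2).div_const p).sub (h2.div_const (p ^ 2))).congr_deriv ?_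
    rw [Real.rpow_sub_one hx.ne']
    field_simp
    ring
  -- The integral is improper at 0, so the fundamental theorem needs the limit of the antiderivative
  -- there; x^p log x → 0 since p > 0.
  have h0 : Tendsto (fun x : ℝ => (Real.log x * x ^ p) / p - x ^ p / p ^ 2) (𝓝[>] 0)
      (𝓝 (0 / p - 0 / p ^ 2)) := by
    refine ((tendsto_log_mul_rpow_nhdsGT_zero hp).div_const p).sub (Tendsto.div_const ?_ _)
    have := (Real.continuousAt_rpow_const 0 p (Or.inr hp.le)).tendsto
    rw [Real.zero_rpow hp.ne'] at this
    exact this.mono_left nhdsWithin_le_nhds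
  rw [intervalIntegral.integral_eq_sub_of_hasDerivAt_of_tendsto hA (fun x hx => hder x hx.1)
    ((intervalIntegrable_iff_integrableOn_Ioc_of_le hA.le).2
      (integrableOn_rpow_mul_log_Ioc hA hp)) h0
    ((hder A hA).continuousAt.tendsto.mono_left nhdsWithin_le_nhds)]
  field_simp
  ring

variable {ξ : ℝ}

theorem pointingLaw_eq (A ξ : ℝ) :
    pointingLaw A ξ = (volume.restrict (Set.Ioc 0 A)).withDensity
      fun x => ENNReal.ofReal (ξ ^ 2 / A ^ (ξ ^ 2) * x ^ (ξ ^ 2 - 1)) := by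
  rw [← withDensity_indicator measurableSet_Ioc, pointingLaw]
  refine withDensity_congr_ae ?_
  filter_upwards [Measure.ae_ne volume (0 : ℝ)] with x hx
  unfold pointingPDF
  by_cases h : 0 ≤ x ∧ x ≤ A
  · rw [if_pos h, Set.indicator_of_mem (Set.mem_Ioc.2 ⟨lt_of_le_of_ne h.1 hx.symm, h.2⟩)]
  · rw [if_neg h, Set.indicator_of_notMem (fun h' => h ⟨h'.1.le, h'.2⟩), ENNReal.ofReal_zero]

theorem measurable_pointingDensity (A p : ℝ) :
    Measurable fun x : ℝ => p / A ^ p * x ^ (p - 1) := by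
  fun_prop

theorem pointingDensity_nonneg (hA : 0 < A) (hp : 0 < p) :
    0 ≤ᵐ[volume.restrict (Set.Ioc 0 A)] fun x : ℝ => p / A ^ p * x ^ (p - 1) := by
  filter_upwards [ae_restrict_mem measurableSet_Ioc] with x hx
  have hx' : 0 < x := hx.1
  simp only [Pi.zero_apply]
  positivity

theorem isProbabilityMeasure_pointingLaw (hA : 0 < A) (hξ : 0 < ξ) :
    IsProbabilityMeasure (pointingLaw A ξ) := by
  have hp : 0 < ξ ^ 2 := by positivity
  rw [pointingLaw_eq]
  refine isProbabilityMeasure_withDensity_ofReal ((integrableOn_rpow_Ioc hA hp).const_mul _)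
    (pointingDensity_nonneg hA hp) ?_
  rw [integral_const_mul, integral_rpow_Ioc hA hp]
  have : A ^ ξ ^ 2 ≠ 0 := (Real.rpow_pos_of_pos hA _).ne'
  field_simp

theorem ae_mem_Ioc_pointingLaw (A ξ : ℝ) : ∀ᵐ x ∂(pointingLaw A ξ), x ∈ Set.Ioc 0 A := by
  rw [pointingLaw_eq]
  exact (withDensity_absolutelyContinuous _ _).ae_le (ae_restrict_mem measurableSet_Ioc)

theorem integrable_log_pointingLaw (hA : 0 < A) (hξ : 0 < ξ) :
    Integrable Real.log (pointingLaw A ξ) := by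
  have hp : 0 < ξ ^ 2 := by positivity
  rw [pointingLaw_eq, integrable_withDensity_ofReal_iff (measurable_pointingDensity A _)
    (pointingDensity_nonneg hA hp)]
  simp_rw [mul_assoc]
  exact (integrableOn_rpow_mul_log_Ioc hA hp).const_mul _

theorem integral_log_pointingLaw (hA : 0 < A) (hξ : 0 < ξ) :
    ∫ x, Real.log x ∂(pointingLaw A ξ) = Real.log A - 1 / ξ ^ 2 := by
  have hp : 0 < ξ ^ 2 := by positivity
  rw [pointingLaw_eq, integral_withDensity_ofReal (measurable_pointingDensity A _)
    (pointingDensity_nonneg hA hp)]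
  simp_rw [mul_assoc]
  rw [integral_const_mul, integral_rpow_mul_log_Ioc hA hp]
  have : A ^ ξ ^ 2 ≠ 0 := (Real.rpow_pos_of_pos hA _).ne'
  field_simp

theorem pointingLaw_real_Ioi_pos (hA : 0 < A) (hξ : 0 < ξ) {r : ℝ} (hr0 : 0 ≤ r) (hr : r < A) :
    0 < (pointingLaw A ξ).real (Set.Ioi r) := by
  have := isProbabilityMeasure_pointingLaw hA hξ
  refine ENNReal.toReal_pos ?_ (measure_ne_top _ _)
  rw [pointingLaw_eq, Ne, withDensity_apply_eq_zero (measurable_pointingDensity A _).ennreal_ofReal]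
  intro h
  have hsub : Set.Ioo r A ⊆
      {x : ℝ | ENNReal.ofReal (ξ ^ 2 / A ^ ξ ^ 2 * x ^ (ξ ^ 2 - 1)) ≠ 0} ∩ Set.Ioi r := by
    intro x hx
    have hx0 : 0 < x := hr0.trans_lt hx.1
    refine ⟨?_, hx.1⟩
    simp only [Set.mem_ofPred_eq, Ne, ENNReal.ofReal_eq_zero, not_le]
    positivity
  have h2 := measure_mono_null hsub h
  have hsub2 : Set.Ioo r A ⊆ Set.Ioc 0 A := fun x hx => ⟨hr0.trans_lt hx.1, hx.2.le⟩
  rw [Measure.restrict_apply measurableSet_Ioo, Set.inter_eq_left.2 hsub2, Real.volume_Ioo,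
    ENNReal.ofReal_eq_zero] at h2
  linarith

end PointingLaw

/-! ### Gamma-Gamma law as a product of independent gamma variables. -/

section TurbulenceLaw

variable {a b : ℝ}

theorem lintegral_eq_ofReal_mul_lintegral_comp_mul {r : ℝ} (hr : 0 < r) {g : ℝ → ENNReal}
    (hg : Measurable g) : ∫⁻ s, g s = ENNReal.ofReal r * ∫⁻ x, g (r * x) := by
  conv_lhs => rw [← Real.smul_map_volume_mul_left hr.ne']
  rw [lintegral_smul_measure, lintegral_map hg (measurable_const_mul r), abs_of_pos hr,
    smul_eq_mul]

theorem measurable_gammaPDF (a r : ℝ) : Measurable (gammaPDF a r) :=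
  (measurable_gammaPDFReal a r).ennreal_ofReal

/-- Density at `x` of the product of two independent gamma variables, scaled by `1 / c`. -/
noncomputable def gammaProductDensity (a b c x : ℝ) : ENNReal :=
  ∫⁻ t, ENNReal.ofReal (c / t) * gammaPDF a 1 (c / t * x) ∂(gammaMeasure b 1)

theorem measurable_gammaProductDensity_integrand (a c : ℝ) :
    Measurable fun q : ℝ × ℝ => ENNReal.ofReal (c / q.2) * gammaPDF a 1 (c / q.2 * q.1) :=
  ((measurable_const.div measurable_snd).ennreal_ofReal).mul
    ((measurable_gammaPDF a 1).comp ((measurable_const.div measurable_snd).mul measurable_fst))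

theorem measurable_gammaProductDensity (hb : 0 < b) (a c : ℝ) :
    Measurable (gammaProductDensity a b c) := by
  have := isProbabilityMeasure_gammaMeasure hb one_pos
  exact (measurable_gammaProductDensity_integrand a c).lintegral_prod_right'

/-- For fixed t the substitution s = (c/t)x has Jacobian c/t; Tonelli then moves the average over t
inside. -/
theorem map_mul_div_gammaMeasure_prod (ha : 0 < a) (hb : 0 < b) {c : ℝ} (hc : 0 < c) :
    ((gammaMeasure a 1).prod (gammaMeasure b 1)).map (fun q : ℝ × ℝ => q.1 * q.2 / c)
      = volume.withDensity (gammaProductDensity a b c) := by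
  have := isProbabilityMeasure_gammaMeasure ha one_pos
  have := isProbabilityMeasure_gammaMeasure hb one_pos
  have hm : Measurable fun q : ℝ × ℝ => q.1 * q.2 / c := by fun_prop
  refine Measure.ext_of_lintegral _ fun f hf => ?_
  have hfm : Measurable fun q : ℝ × ℝ => f (q.1 * q.2 / c) := hf.comp hm
  rw [lintegral_map hf hm, lintegral_prod_symm _ hfm.aemeasurable,
    lintegral_withDensity_eq_lintegral_mul _ (measurable_gammaProductDensity hb a c) hf]
  have hstep : ∀ᵐ t ∂(gammaMeasure b 1), ∫⁻ s, f (s * t / c) ∂(gammaMeasure a 1)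
      = ∫⁻ x, ENNReal.ofReal (c / t) * gammaPDF a 1 (c / t * x) * f x := by
    filter_upwards [ae_pos_gammaMeasure_one b] with t ht
    have hm2 : Measurable fun s : ℝ => f (s * t / c) := hf.comp (by fun_prop)
    rw [gammaMeasure, lintegral_withDensity_eq_lintegral_mul _ (measurable_gammaPDF a 1) hm2,
      lintegral_eq_ofReal_mul_lintegral_comp_mul (div_pos hc ht)
        ((measurable_gammaPDF a 1).mul hm2), ← lintegral_const_mul']
    · refine lintegral_congr fun x => ?_
      have e : c / t * x * t / c = x := by field_simp
      simp only [Pi.mul_apply, e]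
      rw [mul_assoc]
    · exact ENNReal.ofReal_ne_top
  rw [lintegral_congr_ae hstep, lintegral_lintegral_swap]
  · refine lintegral_congr fun x => ?_
    rw [Pi.mul_apply, gammaProductDensity, ← lintegral_mul_const]
    exact (measurable_gammaProductDensity_integrand a c).comp measurable_prodMk_left
  · refine Measurable.aemeasurable ?_
    exact ((measurable_gammaProductDensity_integrand a c).comp measurable_swap).mul
      (hf.comp measurable_snd)

theorem gammaProductDensity_of_neg {x c : ℝ} (hc : 0 < c) (hx : x < 0) :
    gammaProductDensity a b c x = 0 := by
  rw [gammaProductDensity, lintegral_eq_zero_of_ae_eq_zero]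
  filter_upwards [ae_pos_gammaMeasure_one b] with t ht
  rw [gammaPDF_of_neg (mul_neg_of_pos_of_neg (div_pos hc ht) hx), mul_zero, Pi.zero_apply]

theorem gammaProductDensity_of_pos (ha : 0 < a) (hb : 0 < b) {x c : ℝ} (hc : 0 < c)
    (hx : 0 < x) :
    gammaProductDensity a b c x = ∫⁻ t in Set.Ioi 0, ENNReal.ofReal
      (c ^ a * x ^ (a - 1) / (Real.Gamma a * Real.Gamma b)
        * (Real.exp (-t - c * x / t) * t ^ (b - a - 1))) := by
  have hΓa := Real.Gamma_pos_of_pos ha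
  have hΓb := Real.Gamma_pos_of_pos hb
  have hm : Measurable fun t : ℝ => ENNReal.ofReal (c / t) * gammaPDF a 1 (c / t * x) :=
    (measurable_gammaProductDensity_integrand a c).comp measurable_prodMk_left
  rw [gammaProductDensity, gammaMeasure_one_eq, lintegral_withDensity_eq_lintegral_mul _
    (measurable_gammaDensity b).ennreal_ofReal hm]
  refine setLIntegral_congr_fun measurableSet_Ioi fun t ht => ?_
  have ht' : 0 < t := ht
  simp only [Pi.mul_apply]
  rw [gammaPDF_of_nonneg (by positivity), ← ENNReal.ofReal_mul (by positivity),
    ← ENNReal.ofReal_mul (by positivity)]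
  congr 1
  have e : t ^ (b - a - 1) = t ^ (b - 1) / t ^ (a - 1) / t := by
    rw [show b - a - 1 = (b - 1) - (a - 1) - 1 by ring, Real.rpow_sub_one ht'.ne',
      Real.rpow_sub ht' (b - 1) (a - 1)]
  rw [e, Real.one_rpow, one_mul, Real.mul_rpow (by positivity) hx.le,
    Real.div_rpow hc.le ht'.le, Real.rpow_sub_one hc.ne',
    show -t - c * x / t = -t + -(c * x / t) by ring, Real.exp_add,
    show c / t * x = c * x / t by ring]
  field_simp

/-- At z = 2√(abx) and order a - b, the integral defining `besselK` has z²/(4t) = abx/t and power b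
- a - 1, which is the integrand in `gammaProductDensity_of_pos` with c = ab. -/
theorem gammaGammaPDF_of_pos {x : ℝ} (ha : 0 < a) (hb : 0 < b) (hx : 0 < x) :
    gammaGammaPDF a b x = (a * b) ^ a * x ^ (a - 1) / (Real.Gamma a * Real.Gamma b)
      * ∫ t in Set.Ioi 0, Real.exp (-t - a * b * x / t) * t ^ (b - a - 1) := by
  have hab : 0 < a * b := mul_pos ha hb
  have hy : 0 < a * b * x := by positivity
  have e1 : (2 * Real.sqrt (a * b * x) / 2) ^ (a - b)
      = (a * b) ^ ((a - b) / 2) * x ^ ((a - b) / 2) := by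
    rw [mul_div_cancel_left₀ _ two_ne_zero, Real.sqrt_eq_rpow, ← Real.rpow_mul hy.le,
      ← Real.mul_rpow hab.le hx.le]
    congr 1
    ring
  have e2 : ∀ t : ℝ, (2 * Real.sqrt (a * b * x)) ^ 2 / (4 * t) = a * b * x / t := by
    intro t
    rw [mul_pow, Real.sq_sqrt hy.le, show (2 : ℝ) ^ 2 = 4 by norm_num,
      mul_div_mul_left _ _ (by norm_num)]
  rw [gammaGammaPDF, if_pos hx, besselK, e1]
  simp_rw [e2]
  rw [show -(a - b) - 1 = b - a - 1 by ring]
  have e3 : (a * b) ^ a = (a * b) ^ ((a + b) / 2) * (a * b) ^ ((a - b) / 2) := by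
    rw [← Real.rpow_add hab]
    congr 1
    ring
  have e4 : x ^ (a - 1) = x ^ ((a + b) / 2 - 1) * x ^ ((a - b) / 2) := by
    rw [← Real.rpow_add hx]
    congr 1
    ring
  rw [e3, e4]
  ring

/-- The Gamma-Gamma distribution is the law of the product of two independent gamma variables of
mean one. -/
theorem turbulenceLaw_eq_map (ha : 0 < a) (hb : 0 < b) :
    turbulenceLaw a b = ((gammaMeasure a 1).prod (gammaMeasure b 1)).map
      fun q : ℝ × ℝ => q.1 * q.2 / (a * b) := by
  have := isProbabilityMeasure_gammaMeasure ha one_pos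
  have := isProbabilityMeasure_gammaMeasure hb one_pos
  have hab : 0 < a * b := mul_pos ha hb
  have hΓa := Real.Gamma_pos_of_pos ha
  have hΓb := Real.Gamma_pos_of_pos hb
  have hmap := map_mul_div_gammaMeasure_prod ha hb hab
  -- Finite total mass makes the product density finite almost everywhere. This supplies
  -- integrability of the Bessel integrand, so that its Bochner integral is not the default 0.
  have hfin : ∫⁻ x, gammaProductDensity a b (a * b) x ≠ ⊤ := by
    have h := congrArg (fun μ : Measure ℝ => μ Set.univ) hmap
    simp only [withDensity_apply _ MeasurableSet.univ, Measure.restrict_univ] at h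
    rw [← h, Measure.map_apply (by fun_prop) MeasurableSet.univ]
    exact measure_ne_top _ _
  rw [hmap, turbulenceLaw]
  refine withDensity_congr_ae ?_
  filter_upwards [Measure.ae_ne volume (0 : ℝ),
    ae_lt_top (measurable_gammaProductDensity hb a (a * b)) hfin] with x hx0 hx
  rcases lt_or_gt_of_ne hx0 with h | h
  · rw [gammaProductDensity_of_neg hab h, gammaGammaPDF, if_neg h.not_gt, ENNReal.ofReal_zero]
  · rw [gammaProductDensity_of_pos ha hb hab h] at hx ⊢
    have hnn : 0 ≤ᵐ[volume.restrict (Set.Ioi (0 : ℝ))] fun t : ℝ =>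
        (a * b) ^ a * x ^ (a - 1) / (Real.Gamma a * Real.Gamma b)
          * (Real.exp (-t - a * b * x / t) * t ^ (b - a - 1)) := by
      filter_upwards [ae_restrict_mem measurableSet_Ioi] with t ht
      have ht' : 0 < t := ht
      simp only [Pi.zero_apply]
      positivity
    have hi := (lintegral_ofReal_ne_top_iff_integrable
      (Measurable.aestronglyMeasurable (by fun_prop)) hnn).1 hx.ne
    rw [← ofReal_integral_eq_lintegral_ofReal hi hnn, integral_const_mul,
      gammaGammaPDF_of_pos ha hb h]

end TurbulenceLaw

/-! ### The channel gain: positivity, tail, and mean logarithm. -/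

section GainLaw

variable {a b A ξ : ℝ}

/-- Joint law of the two gamma variables and the pointing error that make up the gain. -/
noncomputable def factorLaw (a b A ξ : ℝ) : Measure ((ℝ × ℝ) × ℝ) :=
  ((gammaMeasure a 1).prod (gammaMeasure b 1)).prod (pointingLaw A ξ)

theorem isProbabilityMeasure_factorLaw (ha : 0 < a) (hb : 0 < b) (hA : 0 < A) (hξ : 0 < ξ) :
    IsProbabilityMeasure (factorLaw a b A ξ) := by
  have := isProbabilityMeasure_gammaMeasure ha one_pos
  have := isProbabilityMeasure_gammaMeasure hb one_pos
  have := isProbabilityMeasure_pointingLaw hA hξ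
  unfold factorLaw
  infer_instance

theorem measurable_gain (a b : ℝ) :
    Measurable fun q : (ℝ × ℝ) × ℝ => q.1.1 * q.1.2 / (a * b) * q.2 := by
  fun_prop

theorem gainLaw_eq_map (ha : 0 < a) (hb : 0 < b) (hA : 0 < A) (hξ : 0 < ξ) :
    gainLaw a b A ξ = (factorLaw a b A ξ).map
      fun q : (ℝ × ℝ) × ℝ => q.1.1 * q.1.2 / (a * b) * q.2 := by
  have := isProbabilityMeasure_gammaMeasure ha one_pos
  have := isProbabilityMeasure_gammaMeasure hb one_pos
  have := isProbabilityMeasure_pointingLaw hA hξ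
  have hm : Measurable fun q : ℝ × ℝ => q.1 * q.2 / (a * b) := by fun_prop
  have h := Measure.map_prod_map ((gammaMeasure a 1).prod (gammaMeasure b 1))
    (pointingLaw A ξ) hm measurable_id
  rw [Measure.map_id] at h
  rw [gainLaw, turbulenceLaw_eq_map ha hb, h,
    Measure.map_map (by fun_prop) (hm.prodMap measurable_id)]
  rfl

theorem isProbabilityMeasure_gainLaw (ha : 0 < a) (hb : 0 < b) (hA : 0 < A) (hξ : 0 < ξ) :
    IsProbabilityMeasure (gainLaw a b A ξ) := by
  have := isProbabilityMeasure_factorLaw ha hb hA hξ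
  rw [gainLaw_eq_map ha hb hA hξ]
  exact Measure.isProbabilityMeasure_map (measurable_gain a b).aemeasurable

theorem ae_factorLaw (ha : 0 < a) (hb : 0 < b) (hA : 0 < A) (hξ : 0 < ξ) :
    ∀ᵐ q ∂(factorLaw a b A ξ), 0 < q.1.1 ∧ 0 < q.1.2 ∧ q.2 ∈ Set.Ioc 0 A := by
  have := isProbabilityMeasure_gammaMeasure ha one_pos
  have := isProbabilityMeasure_gammaMeasure hb one_pos
  have := isProbabilityMeasure_pointingLaw hA hξ
  have h1 := Measure.quasiMeasurePreserving_fst (μ := (gammaMeasure a 1).prod (gammaMeasure b 1))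
    (ν := pointingLaw A ξ)
  have h2 := Measure.quasiMeasurePreserving_snd (μ := (gammaMeasure a 1).prod (gammaMeasure b 1))
    (ν := pointingLaw A ξ)
  have h3 := h1.ae (Measure.quasiMeasurePreserving_fst.ae (ae_pos_gammaMeasure_one a))
  have h4 := h1.ae (Measure.quasiMeasurePreserving_snd.ae (ae_pos_gammaMeasure_one b))
  filter_upwards [h3, h4, h2.ae (ae_mem_Ioc_pointingLaw A ξ)] with q hs ht hv
  exact ⟨hs, ht, hv⟩

theorem ae_pos_gainLaw (ha : 0 < a) (hb : 0 < b) (hA : 0 < A) (hξ : 0 < ξ) :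
    ∀ᵐ x ∂(gainLaw a b A ξ), 0 < x := by
  rw [gainLaw_eq_map ha hb hA hξ,
    ae_map_iff (measurable_gain a b).aemeasurable measurableSet_Ioi]
  filter_upwards [ae_factorLaw ha hb hA hξ] with q hq
  have := hq.1
  have := hq.2.1
  have := hq.2.2.1
  positivity

theorem sqrtExpIntegrable_gainLaw (ha : 0 < a) (hb : 0 < b) (hA : 0 < A) (hξ : 0 < ξ) :
    SqrtExpIntegrable (gainLaw a b A ξ) (a * b / A) := by
  intro θ hθ hθ1
  have := isProbabilityMeasure_gammaMeasure ha one_pos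
  have := isProbabilityMeasure_gammaMeasure hb one_pos
  have := isProbabilityMeasure_pointingLaw hA hξ
  have hm : Measurable fun x : ℝ => Real.exp (2 * θ * Real.sqrt (a * b / A * x)) := by fun_prop
  rw [gainLaw_eq_map ha hb hA hξ, integrable_map_measure hm.aestronglyMeasurable
    (measurable_gain a b).aemeasurable]
  have hi := ((integrable_exp_gammaMeasure_one ha hθ1).mul_prod
    (integrable_exp_gammaMeasure_one hb hθ1)).comp_fst (pointingLaw A ξ)
  refine Integrable.mono' hi (hm.comp (measurable_gain a b)).aestronglyMeasurable ?_
  filter_upwards [ae_factorLaw ha hb hA hξ] with q hq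
  obtain ⟨hs, ht, hv, hvA⟩ := hq
  rw [Function.comp_apply, Real.norm_of_nonneg (Real.exp_pos _).le, ← Real.exp_add]
  refine Real.exp_le_exp.2 ?_
  -- AM-GM with v ≤ A gives 2√(cx) ≤ s + t, so the exponential moment is bounded by a product of two
  -- gamma moments, finite for θ < 1.
  have h1 : a * b / A * (q.1.1 * q.1.2 / (a * b) * q.2) ≤ ((q.1.1 + q.1.2) / 2) ^ 2 := by
    have e : a * b / A * (q.1.1 * q.1.2 / (a * b) * q.2) = q.1.1 * q.1.2 * (q.2 / A) := by
      field_simp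
    have h2 : q.2 / A ≤ 1 := (div_le_one hA).2 hvA
    have h3 : q.1.1 * q.1.2 * (q.2 / A) ≤ q.1.1 * q.1.2 * 1 :=
      mul_le_mul_of_nonneg_left h2 (by positivity)
    rw [e]
    nlinarith [sq_nonneg (q.1.1 - q.1.2)]
  have h2 := Real.sqrt_le_sqrt h1
  rw [Real.sqrt_sq (by positivity)] at h2
  nlinarith

theorem sqrtExpTail_gainLaw (ha : 0 < a) (hb : 0 < b) (hA : 0 < A) (hξ : 0 < ξ) :
    SqrtExpTail (gainLaw a b A ξ) (a * b / A) := by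
  intro ε hε
  have := isProbabilityMeasure_gammaMeasure ha one_pos
  have := isProbabilityMeasure_gammaMeasure hb one_pos
  have := isProbabilityMeasure_pointingLaw hA hξ
  have := isProbabilityMeasure_factorLaw ha hb hA hξ
  have hc : 0 < a * b / A := by positivity
  -- With φ = √(cy), the two gamma tails at κφ cost 2κ²φ = (2 + ε)φ in the exponent. Out of (2 +
  -- 2ε)φ this leaves εφ to absorb the mass of V > A/κ², which does not depend on y.
  set κ := Real.sqrt (1 + ε / 2) with hκ
  have hκ2 : κ ^ 2 = 1 + ε / 2 := Real.sq_sqrt (by positivity)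
  have hκ1 : 1 < κ := by
    rw [hκ, Real.lt_sqrt zero_le_one]
    linarith
  have hκ0 : 0 < κ := by linarith
  have hAκ : A / κ ^ 2 < A := div_lt_self hA (by nlinarith)
  have hp := pointingLaw_real_Ioi_pos hA hξ (by positivity) hAκ
  have hr : Tendsto (fun y : ℝ => κ * Real.sqrt (a * b / A * y)) atTop atTop :=
    (tendsto_sqrt_mul_atTop hc).const_mul_atTop hκ0
  filter_upwards [hr.eventually (eventually_exp_le_gammaMeasure_one ha hκ1),
    hr.eventually (eventually_exp_le_gammaMeasure_one hb hκ1), eventually_gt_atTop 0,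
    eventually_le_exp_mul_sqrt hc hε (1 / (pointingLaw A ξ).real (Set.Ioi (A / κ ^ 2)))]
    with y h1 h2 hy h3
  rw [div_le_iff₀ hp] at h3
  set φ := Real.sqrt (a * b / A * y) with hφ
  have hφ0 : 0 < φ := Real.sqrt_pos.2 (by positivity)
  have hφ2 : φ ^ 2 = a * b / A * y := Real.sq_sqrt (by positivity)
  have hsub : (Set.Ioi (κ * φ) ×ˢ Set.Ioi (κ * φ)) ×ˢ Set.Ioi (A / κ ^ 2) ⊆
      (fun q : (ℝ × ℝ) × ℝ => q.1.1 * q.1.2 / (a * b) * q.2) ⁻¹' Set.Ioi y := by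
    rintro ⟨⟨s, t⟩, v⟩ ⟨⟨hs, ht⟩, hv⟩
    have hs' : κ * φ < s := hs
    have ht' : κ * φ < t := ht
    have hv' : A / κ ^ 2 < v := hv
    have hκφ : 0 < κ * φ := by positivity
    have hAκ0 : 0 < A / κ ^ 2 := by positivity
    have hst : κ * φ * (κ * φ) < s * t := mul_lt_mul'' hs' ht' hκφ.le hκφ.le
    have hstv : κ * φ * (κ * φ) * (A / κ ^ 2) < s * t * v :=
      mul_lt_mul'' hst hv' (by positivity) hAκ0.le
    -- The factor κ² gained from the gamma variables cancels the loss in V, so the corner of the box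
    -- has gain exactly y.
    have e : κ * φ * (κ * φ) * (A / κ ^ 2) = y * (a * b) := by
      rw [show κ * φ * (κ * φ) * (A / κ ^ 2) = φ ^ 2 * A by field_simp, hφ2]
      field_simp
    rw [e] at hstv
    simp only [Set.mem_preimage, Set.mem_Ioi]
    rw [div_mul_eq_mul_div, lt_div_iff₀ (by positivity)]
    exact hstv
  have hge : (gammaMeasure a 1).real (Set.Ioi (κ * φ)) * (gammaMeasure b 1).real (Set.Ioi (κ * φ))
      * (pointingLaw A ξ).real (Set.Ioi (A / κ ^ 2)) ≤ (gainLaw a b A ξ).real (Set.Ioi y) := by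
    rw [gainLaw_eq_map ha hb hA hξ, map_measureReal_apply (measurable_gain a b) measurableSet_Ioi,
      ← measureReal_prod_prod, ← measureReal_prod_prod]
    exact measureReal_mono hsub
  refine le_trans ?_ hge
  calc Real.exp (-(2 * (1 + ε) * φ))
      ≤ Real.exp (-(2 * (1 + ε) * φ)) *
          (Real.exp (ε * φ) * (pointingLaw A ξ).real (Set.Ioi (A / κ ^ 2))) :=
        le_mul_of_one_le_right (Real.exp_pos _).le h3
    _ = Real.exp (-(κ * (κ * φ))) * Real.exp (-(κ * (κ * φ)))
          * (pointingLaw A ξ).real (Set.Ioi (A / κ ^ 2)) := by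
        rw [← mul_assoc, ← Real.exp_add, ← Real.exp_add]
        congr 2
        rw [show κ * (κ * φ) = κ ^ 2 * φ by ring, hκ2]
        ring
    _ ≤ _ := by gcongr

theorem integrable_and_integral_log_gainLaw (ha : 0 < a) (hb : 0 < b) (hA : 0 < A)
    (hξ : 0 < ξ) :
    Integrable Real.log (gainLaw a b A ξ) ∧ ∫ x, Real.log x ∂(gainLaw a b A ξ)
      = Real.log (A / (a * b)) + psi a + psi b - 1 / ξ ^ 2 := by
  have := isProbabilityMeasure_gammaMeasure ha one_pos
  have := isProbabilityMeasure_gammaMeasure hb one_pos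
  have := isProbabilityMeasure_pointingLaw hA hξ
  have := isProbabilityMeasure_factorLaw ha hb hA hξ
  have hab : 0 < a * b := mul_pos ha hb
  have i1 : Integrable (fun q : (ℝ × ℝ) × ℝ => Real.log q.1.1) (factorLaw a b A ξ) :=
    ((integrable_log_gammaMeasure_one ha).comp_fst (gammaMeasure b 1)).comp_fst (pointingLaw A ξ)
  have i2 : Integrable (fun q : (ℝ × ℝ) × ℝ => Real.log q.1.2) (factorLaw a b A ξ) :=
    ((integrable_log_gammaMeasure_one hb).comp_snd (gammaMeasure a 1)).comp_fst (pointingLaw A ξ)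
  have i3 : Integrable (fun q : (ℝ × ℝ) × ℝ => Real.log q.2) (factorLaw a b A ξ) :=
    (integrable_log_pointingLaw hA hξ).comp_snd ((gammaMeasure a 1).prod (gammaMeasure b 1))
  have v1 : ∫ q, Real.log q.1.1 ∂(factorLaw a b A ξ) = psi a := by
    rw [factorLaw, integral_fun_fst (fun r : ℝ × ℝ => Real.log r.1), integral_fun_fst,
      integral_log_gammaMeasure_one ha]
    simp
  have v2 : ∫ q, Real.log q.1.2 ∂(factorLaw a b A ξ) = psi b := by
    rw [factorLaw, integral_fun_fst (fun r : ℝ × ℝ => Real.log r.2), integral_fun_snd,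
      integral_log_gammaMeasure_one hb]
    simp
  have v3 : ∫ q, Real.log q.2 ∂(factorLaw a b A ξ) = Real.log A - 1 / ξ ^ 2 := by
    rw [factorLaw, integral_fun_snd, integral_log_pointingLaw hA hξ]
    simp
  have hae : (fun q : (ℝ × ℝ) × ℝ => Real.log q.1.1 + Real.log q.1.2 + Real.log q.2
      - Real.log (a * b)) =ᵐ[factorLaw a b A ξ]
      fun q => Real.log (q.1.1 * q.1.2 / (a * b) * q.2) := by
    filter_upwards [ae_factorLaw ha hb hA hξ] with q hq
    obtain ⟨hs, ht, hv, -⟩ := hq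
    rw [Real.log_mul (by positivity) hv.ne', Real.log_div (by positivity) hab.ne',
      Real.log_mul hs.ne' ht.ne']
    ring
  have i12 : Integrable (fun q : (ℝ × ℝ) × ℝ => Real.log q.1.1 + Real.log q.1.2)
      (factorLaw a b A ξ) := i1.add i2
  have i123 : Integrable (fun q : (ℝ × ℝ) × ℝ => Real.log q.1.1 + Real.log q.1.2 + Real.log q.2)
      (factorLaw a b A ξ) := i12.add i3
  have hlog := Real.measurable_log.aestronglyMeasurable
    (μ := (factorLaw a b A ξ).map fun q => q.1.1 * q.1.2 / (a * b) * q.2)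
  rw [gainLaw_eq_map ha hb hA hξ, integrable_map_measure hlog (measurable_gain a b).aemeasurable,
    integral_map (measurable_gain a b).aemeasurable hlog]
  refine ⟨(i123.sub (integrable_const _)).congr hae, ?_⟩
  rw [← integral_congr_ae hae, integral_sub i123 (integrable_const _), integral_add i12 i3,
    integral_add i1 i2, v1, v2, v3, Real.log_div hA.ne' hab.ne']
  simp
  ring

end GainLaw

end FSO

/-! ### Specialization to the channel gain, with c = ab/A₀. -/

theorem theorem3 (a b A0 ξ : ℝ) (ha : 0 < a) (hb : 0 < b) (hA0 : 0 < A0) (hA1 : A0 ≤ 1)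
    (hξ : 0 < ξ) (k : ℕ) (hk : k = 1 ∨ k = 2) (N : ℝ) (hN : 0 < N) :
    -- the capacity is a maximum, attained by waterfilling with a uniquely determined threshold
    (∀ SNR : ℝ, 0 < SNR →
      (∃! μ : ℝ, FSO.IsThreshold (FSO.gainLaw a b A0 ξ) SNR μ) ∧
      ∀ μ : ℝ, FSO.IsThreshold (FSO.gainLaw a b A0 ξ) SNR μ →
        FSO.waterfilling N μ ∈ FSO.feasiblePolicies (FSO.gainLaw a b A0 ξ) (SNR * N) ∧
        IsGreatest
          (FSO.averageRate (FSO.gainLaw a b A0 ξ) k N ''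
            FSO.feasiblePolicies (FSO.gainLaw a b A0 ξ) (SNR * N))
          (FSO.averageRate (FSO.gainLaw a b A0 ξ) k N (FSO.waterfilling N μ)) ∧
        FSO.ergodicCapacity (FSO.gainLaw a b A0 ξ) k (SNR * N) N
          = 1 / (k : ℝ) * ∫ x in Set.Ioi μ, Real.log (x / μ) ∂(FSO.gainLaw a b A0 ξ)) ∧
    -- low SNR
    (fun SNR : ℝ => FSO.ergodicCapacity (FSO.gainLaw a b A0 ξ) k (SNR * N) N)
      ~[𝓝[>] 0]
      (fun SNR : ℝ => 1 / (k : ℝ) * (A0 / (4 * a * b) * SNR * Real.log (1 / SNR) ^ 2)) ∧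
    -- high SNR
    Tendsto
      (fun SNR : ℝ => FSO.ergodicCapacity (FSO.gainLaw a b A0 ξ) k (SNR * N) N
        - 1 / (k : ℝ) * (Real.log SNR + Real.log (A0 / (a * b)) + FSO.psi a + FSO.psi b
            - 1 / ξ ^ 2))
      atTop (𝓝 0) := by
  have := FSO.isProbabilityMeasure_gainLaw ha hb hA0 hξ
  have hc : 0 < a * b / A0 := by positivity
  have hpos := FSO.ae_pos_gainLaw ha hb hA0 hξ
  have he := FSO.sqrtExpIntegrable_gainLaw ha hb hA0 hξ
  have ht := FSO.sqrtExpTail_gainLaw ha hb hA0 hξ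
  have hint := he.integrable_id hc hpos
  obtain ⟨hlog, hval⟩ := FSO.integrable_and_integral_log_gainLaw ha hb hA0 hξ
  refine ⟨fun s hs => ⟨FSO.existsUnique_isThreshold hpos ht.real_Ioi_pos hs, fun μ hμ =>
    ⟨FSO.waterfilling_mem_feasiblePolicies hpos hN hμ,
      FSO.isGreatest_averageRate_waterfilling hpos hint k hN hμ,
      FSO.ergodicCapacity_eq hpos hint k hN hμ⟩⟩, ?_, ?_⟩
  · have h := FSO.isEquivalent_ergodicCapacity hc hpos he ht k hN
    rwa [show 1 / (4 * (a * b / A0)) = A0 / (4 * a * b) by field_simp] at h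
  · refine (FSO.tendsto_ergodicCapacity_sub_log hpos hint hlog k hN).congr fun s => ?_
    rw [hval]
    ring
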